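/- An MV-term is built from variables $X_1,X_2,\dots$ and the constant $0$ with the operations $\neg,\oplus$. For an MV-term $s$ in the variables $X_1,\dots,X_n$, let $\hat s\colon[0,1]^n\to[0,1]$ be its McNaughton function, i.e. the function obtained by reading $X_i$ as the $i$-th coordinate, $\neg x$ as $1-x$ and $x\oplus y$ as $\min(1,x+y)$. A subset $D$ of a topological space is called a closed domain if $\operatorname{cl}(\operatorname{int}(D))=D$. An instance is a finite list $t=(t_1,\dots,t_n)$, $n\ge 1$, of MV-terms in the variables $X_1,\dots,X_n$ such that the map $\hat t=(\hat t_1,\dots,\hat t_n)\colon[0,1]^n\to[0,1]^n$ is idempotent, $\hat t\circ\hat t=\hat t$. For an instance $t$, let $A$ be the MV-algebra of functions $[0,1]^n\to[0,1]$ generated by $\hat t_1,\dots,\hat t_n$ under the pointwise operations, and let $\mu_A$ be its maximal spectrum, i.e. the set of maximal ideals of $A$ with the hull-kernel topology. **Proposition.** 1. It is (Turing) decidable whether a finite list of MV-terms is an instance. 2. The following problem is decidable, uniformly in $n$: given an instance $t=(t_1,\dots,t_n)$, is $\mu_A$ homeomorphic to a closed domain in $[0,1]^n$? 3. More precisely,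 there is a computable function that assigns to every instance $t$ a finite list of simplexes, given by their (rational) vertices, which are the faces of a triangulation of the fixed-point set $\{x\in[0,1]^n \mid \hat t(x)=x\}$, and $\mu_A$ is homeomorphic to a closed domain in $[0,1]^n$ if and only if all maximal simplexes of this triangulation are $n$-dimensional. -/

import Mathlib

open scoped unitInterval

/-! ### MV-algebras -/

/-- MV-algebras: commutative monoids `(A, ⊕, 0)` with an operation `¬` satisfying
`¬¬x = x`, `x ⊕ ¬0 = ¬0` and `¬(¬x ⊕ y) ⊕ y = ¬(¬y ⊕ x) ⊕ x`. -/
class MVAlgebra (A : Type*) where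
  bot : A
  neg : A → A
  oplus : A → A → A
  oplus_assoc : ∀ x y z, oplus (oplus x y) z = oplus x (oplus y z)
  oplus_comm : ∀ x y, oplus x y = oplus y x
  oplus_bot : ∀ x, oplus x bot = x
  neg_neg : ∀ x, neg (neg x) = x
  oplus_neg_bot : ∀ x, oplus x (neg bot) = neg bot
  lukasiewicz : ∀ x y, oplus (neg (oplus (neg x) y)) y = oplus (neg (oplus (neg y) x)) x

/-- The standard MV-algebra `[0,1]`, with `¬x = 1 - x` and `x ⊕ y = min (1, x + y)`. -/
noncomputable instance MVAlgebra.instUnitInterval : MVAlgebra I where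
  bot := 0
  neg x := ⟨1 - x, by constructor <;> linarith [x.2.1, x.2.2]⟩
  oplus x y := ⟨min 1 (x + y),
    le_min zero_le_one (add_nonneg x.2.1 y.2.1), min_le_left _ _⟩
  oplus_assoc x y z := by
    obtain ⟨x, hx0, hx1⟩ := x; obtain ⟨y, hy0, hy1⟩ := y; obtain ⟨z, hz0, hz1⟩ := z
    apply Subtype.ext
    simp only
    rcases min_cases (1 : ℝ) (x + y) with h | h <;> rcases min_cases (1 : ℝ) (y + z) with h' | h'
    all_goals rw [h.1, h'.1]
    · rw [min_eq_left (by linarith), min_eq_left (by linarith)]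
    · rw [min_eq_left (by linarith), min_eq_left (by linarith)]
    · rw [min_eq_left (by linarith), min_eq_left (by linarith)]
    · rw [add_assoc]
  oplus_comm x y := by
    apply Subtype.ext
    simp only
    rw [add_comm]
  oplus_bot x := by
    apply Subtype.ext
    simp only [Set.Icc.coe_zero, add_zero]
    exact min_eq_right x.2.2
  neg_neg x := by
    apply Subtype.ext
    simp
  oplus_neg_bot x := by
    apply Subtype.ext
    simp only [Set.Icc.coe_zero, sub_zero]
    exact min_eq_left (by linarith [x.2.1])
  lukasiewicz x y := by
    obtain ⟨x, hx0, hx1⟩ := x; obtain ⟨y, hy0, hy1⟩ := y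
    apply Subtype.ext
    simp only
    rcases le_total x y with h | h
    · rw [min_eq_left (a := 1) (b := 1 - x + y) (by linarith),
        min_eq_right (a := 1) (b := 1 - y + x) (by linarith),
        min_eq_right (by linarith), min_eq_right (by linarith)]
      ring
    · rw [min_eq_right (a := 1) (b := 1 - x + y) (by linarith),
        min_eq_left (a := 1) (b := 1 - y + x) (by linarith),
        min_eq_right (by linarith), min_eq_right (by linarith)]
      ring

/-- Functions into an MV-algebra form an MV-algebra under the pointwise operations. -/
instance MVAlgebra.instFun {X A : Type*} [MVAlgebra A] : MVAlgebra (X → A) where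
  bot := fun _ => bot
  neg f := fun x => neg (f x)
  oplus f g := fun x => oplus (f x) (g x)
  oplus_assoc _ _ _ := funext fun _ => oplus_assoc _ _ _
  oplus_comm _ _ := funext fun _ => oplus_comm _ _
  oplus_bot _ := funext fun _ => oplus_bot _
  neg_neg _ := funext fun _ => neg_neg _
  oplus_neg_bot _ := funext fun _ => oplus_neg_bot _
  lukasiewicz _ _ := funext fun _ => lukasiewicz _ _

/-- The natural order of an MV-algebra: `x ≤ y` iff `¬x ⊕ y = 1`, where `1 = ¬0`. -/
def MVAlgebra.LE {A : Type*} [MVAlgebra A] (x y : A) : Prop :=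
  oplus (neg x) y = neg bot

/-- MV-subalgebras. -/
@[ext]
structure MVSubalgebra (A : Type*) [MVAlgebra A] where
  carrier : Set A
  bot_mem : MVAlgebra.bot ∈ carrier
  neg_mem : ∀ {x}, x ∈ carrier → MVAlgebra.neg x ∈ carrier
  oplus_mem : ∀ {x y}, x ∈ carrier → y ∈ carrier → MVAlgebra.oplus x y ∈ carrier

/-- An MV-subalgebra is itself an MV-algebra. -/
instance MVSubalgebra.instMVAlgebra {A : Type*} [MVAlgebra A] (B : MVSubalgebra A) :
    MVAlgebra B.carrier where
  bot := ⟨MVAlgebra.bot, B.bot_mem⟩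
  neg x := ⟨MVAlgebra.neg x, B.neg_mem x.2⟩
  oplus x y := ⟨MVAlgebra.oplus x y, B.oplus_mem x.2 y.2⟩
  oplus_assoc _ _ _ := Subtype.ext (MVAlgebra.oplus_assoc _ _ _)
  oplus_comm _ _ := Subtype.ext (MVAlgebra.oplus_comm _ _)
  oplus_bot _ := Subtype.ext (MVAlgebra.oplus_bot _)
  neg_neg _ := Subtype.ext (MVAlgebra.neg_neg _)
  oplus_neg_bot _ := Subtype.ext (MVAlgebra.oplus_neg_bot _)
  lukasiewicz _ _ := Subtype.ext (MVAlgebra.lukasiewicz _ _)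

/-- The MV-subalgebra generated by a set: the smallest one containing it. -/
def MVSubalgebra.gen {A : Type*} [MVAlgebra A] (S : Set A) : MVSubalgebra A where
  carrier := {x | ∀ B : MVSubalgebra A, S ⊆ B.carrier → x ∈ B.carrier}
  bot_mem := fun B _ => B.bot_mem
  neg_mem := fun hx B hB => B.neg_mem (hx B hB)
  oplus_mem := fun hx hy B hB => B.oplus_mem (hx B hB) (hy B hB)

/-! ### Ideals and the maximal spectrum -/

/-- Ideals of an MV-algebra: subsets containing `0`, downward closed, closed under `⊕`. -/
@[ext]
structure MVIdeal (A : Type*) [MVAlgebra A] where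
  carrier : Set A
  bot_mem : MVAlgebra.bot ∈ carrier
  mem_of_le : ∀ {x y}, MVAlgebra.LE x y → y ∈ carrier → x ∈ carrier
  oplus_mem : ∀ {x y}, x ∈ carrier → y ∈ carrier → MVAlgebra.oplus x y ∈ carrier

/-- Maximal ideals: proper ideals that are not strictly contained in another proper ideal. -/
def MVIdeal.IsMaximal {A : Type*} [MVAlgebra A] (J : MVIdeal A) : Prop :=
  J.carrier ≠ Set.univ ∧
    ∀ K : MVIdeal A, K.carrier ≠ Set.univ → J.carrier ⊆ K.carrier → K = J

/-- The maximal spectrum `μ_A`: the set of maximal ideals of `A`. -/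
def MVMaxSpec (A : Type*) [MVAlgebra A] : Type _ := {J : MVIdeal A // J.IsMaximal}

/-- The hull-kernel (spectral) topology, generated by the sets `{J | a ∉ J}` for `a ∈ A`. -/
instance MVMaxSpec.instTopologicalSpace (A : Type*) [MVAlgebra A] :
    TopologicalSpace (MVMaxSpec A) :=
  TopologicalSpace.generateFrom
    {U | ∃ a : A, U = {J : MVMaxSpec A | a ∉ J.1.carrier}}

/-! ### MV-terms -/

/-- MV-terms in the variables `X_1, X_2, …`; here `X_(i+1)` is `var i`. -/
inductive MVTerm : Type
  | zero : MVTerm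
  | var : ℕ → MVTerm
  | neg : MVTerm → MVTerm
  | oplus : MVTerm → MVTerm → MVTerm

namespace MVTerm

/-- The Gödel number of an MV-term. -/
def toNat : MVTerm → ℕ
  | zero => 0
  | var i => 3 * i + 1
  | neg t => 3 * toNat t + 2
  | oplus s t => 3 * Nat.pair (toNat s) (toNat t) + 3

/-- The MV-term with a given Gödel number. -/
def ofNat : ℕ → MVTerm
  | 0 => zero
  | n + 1 =>
    have h1 : n / 3 < n + 1 := by omega
    have h2 : (Nat.unpair (n / 3)).1 < n + 1 := lt_of_le_of_lt (Nat.unpair_left_le _) h1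
    have h3 : (Nat.unpair (n / 3)).2 < n + 1 := lt_of_le_of_lt (Nat.unpair_right_le _) h1
    if n % 3 = 0 then var (n / 3)
    else if n % 3 = 1 then neg (ofNat (n / 3))
    else oplus (ofNat (Nat.unpair (n / 3)).1) (ofNat (Nat.unpair (n / 3)).2)

theorem ofNat_toNat (t : MVTerm) : ofNat (toNat t) = t := by
  induction t with
  | zero => simp [toNat, ofNat]
  | var i =>
    have h1 : 3 * i % 3 = 0 := by omega
    have h2 : 3 * i / 3 = i := by omega
    rw [toNat, ofNat, if_pos h1, h2]
  | neg t ih =>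
    have h1 : (3 * toNat t + 1) % 3 = 1 := by omega
    have h2 : (3 * toNat t + 1) / 3 = toNat t := by omega
    rw [toNat, ofNat, if_neg (by omega), if_pos h1, h2, ih]
  | oplus s t ihs iht =>
    have h1 : (3 * Nat.pair (toNat s) (toNat t) + 2) % 3 = 2 := by omega
    have h2 : (3 * Nat.pair (toNat s) (toNat t) + 2) / 3 = Nat.pair (toNat s) (toNat t) := by
      omega
    rw [toNat, ofNat, if_neg (by omega), if_neg (by omega), h2, Nat.unpair_pair, ihs, iht]

theorem toNat_ofNat (n : ℕ) : toNat (ofNat n) = n := by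
  induction n using Nat.strong_induction_on with
  | _ n ih =>
    cases n with
    | zero => simp [toNat, ofNat]
    | succ n =>
      have h1 : n / 3 < n + 1 := by omega
      have h2 : (Nat.unpair (n / 3)).1 < n + 1 := lt_of_le_of_lt (Nat.unpair_left_le _) h1
      have h3 : (Nat.unpair (n / 3)).2 < n + 1 := lt_of_le_of_lt (Nat.unpair_right_le _) h1
      rw [ofNat]
      split_ifs with ha hb
      · simp only [toNat]; omega
      · simp only [toNat]; rw [ih _ h1]; omega
      · simp only [toNat]; rw [ih _ h2, ih _ h3, Nat.pair_unpair]; omega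

/-- The Gödel numbering is a bijection, hence makes MV-terms a type of finite objects on which
Turing computability makes sense. -/
def equivNat : MVTerm ≃ ℕ := ⟨toNat, ofNat, ofNat_toNat, toNat_ofNat⟩

instance : Primcodable MVTerm := Primcodable.ofEquiv ℕ equivNat

/-- All variables of the term are among the first `n` ones. -/
def VarsBelow (n : ℕ) : MVTerm → Prop
  | zero => True
  | var i => i < n
  | neg t => VarsBelow n t
  | oplus s t => VarsBelow n s ∧ VarsBelow n t

/-- The value of a term in an MV-algebra under an assignment of its variables. -/
def eval {A : Type*} [MVAlgebra A] (v : ℕ → A) : MVTerm → A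
  | zero => MVAlgebra.bot
  | var i => v i
  | neg t => MVAlgebra.neg (eval v t)
  | oplus s t => MVAlgebra.oplus (eval v s) (eval v t)

/-- The coordinate functions `π_i : [0,1]^n → [0,1]` (and, for definiteness, the zero function
when `i` is not one of the `n` coordinates; this never matters for terms in `n` variables). -/
noncomputable def proj (n i : ℕ) : (Fin n → I) → I :=
  if h : i < n then fun x => x ⟨i, h⟩ else fun _ => 0

/-- The McNaughton function `t̂ : [0,1]^n → [0,1]` of a term `t` in `n` variables: the value of
`t` in the MV-algebra of functions on the cube at the coordinate functions. -/
noncomputable def hat (n : ℕ) (t : MVTerm) : (Fin n → I) → I := eval (proj n) t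

end MVTerm

/-! ### The decision problem -/

/-- The map `t̂ = (t̂_1, …, t̂_n) : [0,1]^n → [0,1]^n` of a list of `n` terms. -/
noncomputable def hatMap (t : List MVTerm) : (Fin t.length → I) → (Fin t.length → I) :=
  fun x i => (t.get i).hat t.length x

/-- Lists `t_1, …, t_n` (`n ≥ 1`) of MV-terms in the variables `X_1, …, X_n`
such that `t̂` is idempotent. -/
def IsInstance (t : List MVTerm) : Prop :=
  t ≠ [] ∧ (∀ s ∈ t, s.VarsBelow t.length) ∧ hatMap t ∘ hatMap t = hatMap t

/-- The MV-algebra generated by `t̂_1, …, t̂_n`. -/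
noncomputable def genAlgebra (t : List MVTerm) : MVSubalgebra ((Fin t.length → I) → I) :=
  MVSubalgebra.gen (Set.range fun i : Fin t.length => (t.get i).hat t.length)

/-- A closed domain of a topological space: a set that is the closure of its interior. -/
def IsClosedDomain {X : Type*} [TopologicalSpace X] (D : Set X) : Prop :=
  closure (interior D) = D

/-- The question: is `μ_A` homeomorphic to a closed domain in `[0,1]^n`, where `A` is the
MV-algebra generated by `t̂_1, …, t̂_n`? -/
def MaxSpecIsClosedDomain (t : List MVTerm) : Prop :=
  ∃ D : Set (Fin t.length → I), IsClosedDomain D ∧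
    Nonempty (MVMaxSpec (genAlgebra t).carrier ≃ₜ D)

/-! ### Finitely presented rational simplexes -/

/-- Codes of rational points: `(a, d)` encodes the point with coordinates `a_i / (d + 1)`.
The numerators are natural numbers, as only points of the unit cube are needed. -/
abbrev RatPointCode : Type := List ℕ × ℕ

/-- The point of `ℝ^n` with a given code (missing numerators are read as `0`). -/
noncomputable def RatPointCode.toPoint (n : ℕ) (p : RatPointCode) : Fin n → ℝ :=
  fun i => (p.1.getD i 0 : ℝ) / (p.2 + 1 : ℝ)

/-- The vertex sets of the simplexes in a list, each simplex being given as the list of (the codes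
of) its vertices. -/
def vertexSets (n : ℕ) (L : List (List RatPointCode)) : Set (Finset (Fin n → ℝ)) :=
  {s | ∃ l ∈ L, (s : Set (Fin n → ℝ)) = {x | ∃ p ∈ l, p.toPoint n = x}}

/-- The fixed-point set `{x ∈ [0,1]^n | t̂(x) = x}`, as a subset of `ℝ^n`. -/
def fixedSet (t : List MVTerm) : Set (Fin t.length → ℝ) :=
  {y | ∃ x : Fin t.length → I, hatMap t x = x ∧ y = fun i => (x i : ℝ)}

/-! The map `hatMap t` is a retraction of the cube onto its fixed-point set P. Every function in A
is invariant under it, so A is determined by its restrictions to P, and on P the coordinate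
functions belong to A. Using x ⊕ x and ¬(¬x ⊕ ¬x), A contains, for any two distinct points of P, a
function vanishing at the first but not at the second (`exists_separating`). With compactness it
follows that p ↦ {f | f p = 0} is a homeomorphism from P onto the maximal spectrum
(`nonempty_homeomorph_maxSpec`). The question is therefore about the rational polyhedron P.

To triangulate P, points are written in homogeneous coordinates (numerators, denominator), so that
the cube becomes a cone and McNaughton functions become positively homogeneous; all computations are
then in natural numbers. The cube is cut out of one large simplex. The only operation is stellar
subdivision of an edge at a zero of a function that is linear on the cells; it preserves
embeddedness, the cone, linearity and constancy of sign (`Refines.stellar`), and repeating it makes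
the function change sign on no cell (`cut_spec`). Cutting along s + u = 1 for all subterms s ⊕ u,
inner ones first, makes all given terms linear on the cells (`refineCode_spec`). Idempotence can
then be tested at the vertices (`idempotentCode_iff`), and cutting along t_i = X_i and keeping the
fixed vertices triangulates P (`fixedCode_spec`). Each operation is primitive recursive.

It remains to see when a finite complex K in the cube is homeomorphic to a closed domain. If all
facets have dimension n, then K is itself the closure of its interior (`isClosedDomain_cubePart`).
Conversely, near the barycenter of a facet s, K coincides with s; transported to a closed domain,
this neighbourhood contains a small n-cube, which thus embeds in the affine span of s
(`card_facet_of_homeomorph`). An n-cube does not embed in a space of dimension below n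
(`not_injective_of_finrank_lt`): by Stone–Weierstrass the coordinates would be approximated by C¹
functions on that space, whose joint map misses a dense set of values, against the Poincaré–Miranda
theorem. The latter is proved by a mod 2 cup product of cochains on a cubical grid (`sum_cochain`).
-/

/-! ### Simplicial cones given by lists of cells -/

namespace ConeComplex

variable {V E : Type*} [AddCommGroup E] [Module ℝ E]

/-- The nonnegative weights supported on a cell. -/
def Weights (l : List V) : Set (V →₀ ℝ) :=
  {w | (∀ v, 0 ≤ w v) ∧ ∀ v, w v ≠ 0 → v ∈ l}

/-- The point with given weights. -/
noncomputable abbrev bary (pos : V → E) (w : V →₀ ℝ) : E := Finsupp.linearCombination ℝ pos w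

/-- The geometric realization of the cells is injective. -/
def Embedded (pos : V → E) (L : List (List V)) : Prop :=
  ∀ l ∈ L, ∀ m ∈ L, ∀ w ∈ Weights l, ∀ w' ∈ Weights m, bary pos w = bary pos w' → w = w'

/-- The union of the cones spanned by the cells. -/
def cone (pos : V → E) (L : List (List V)) : Set E :=
  {x | ∃ l ∈ L, ∃ w ∈ Weights l, bary pos w = x}

/-- A function that is linear on every cell. -/
def LinearOn (pos : V → E) (L : List (List V)) (F : E → ℝ) : Prop :=
  ∀ l ∈ L, ∀ w ∈ Weights l, F (bary pos w) = bary (fun v => F (pos v)) w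

/-- A function that changes its sign on no cell. -/
def SignedOn (pos : V → E) (L : List (List V)) (F : E → ℝ) : Prop :=
  ∀ l ∈ L, ∀ p ∈ l, ∀ q ∈ l, F (pos p) < 0 → ¬ 0 < F (pos q)

/-- `M` subdivides `L`. -/
structure Refines (pos : V → E) (L M : List (List V)) : Prop where
  embedded : Embedded pos M
  nodup : ∀ l ∈ M, l.Nodup
  cone_eq : cone pos M = cone pos L
  linearOn : ∀ F, LinearOn pos L F → LinearOn pos M F
  signedOn : ∀ F, LinearOn pos L F → SignedOn pos L F → SignedOn pos M F

theorem Refines.trans {pos : V → E} {L M N : List (List V)} (h : Refines pos L M)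
    (h' : Refines pos M N) : Refines pos L N where
  embedded := h'.embedded
  nodup := h'.nodup
  cone_eq := h'.cone_eq.trans h.cone_eq
  linearOn F hF := h'.linearOn F (h.linearOn F hF)
  signedOn F hF hs := h'.signedOn F (h.linearOn F hF) (h.signedOn F hF hs)

theorem Refines.refl {pos : V → E} {L : List (List V)} (h : Embedded pos L)
    (hn : ∀ l ∈ L, l.Nodup) : Refines pos L L :=
  ⟨h, hn, rfl, fun _ h => h, fun _ _ h => h⟩

theorem single_mem_weights [DecidableEq V] {l : List V} {v : V} (hv : v ∈ l) {a : ℝ} (ha : 0 ≤ a) :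
    Finsupp.single v a ∈ Weights l := by
  refine ⟨fun u => ?_, fun u hu => ?_⟩
  · rw [Finsupp.single_apply]; split_ifs <;> simp [ha]
  · rw [Finsupp.single_apply] at hu
    split_ifs at hu with h
    · exact h ▸ hv
    · exact absurd rfl hu

theorem add_mem_weights {l : List V} {w w' : V →₀ ℝ} (hw : w ∈ Weights l) (hw' : w' ∈ Weights l) :
    w + w' ∈ Weights l := by
  refine ⟨fun v => add_nonneg (hw.1 v) (hw'.1 v), fun v hv => ?_⟩
  by_contra h
  have h1 : w v = 0 := by_contra fun h' => h (hw.2 v h')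
  have h2 : w' v = 0 := by_contra fun h' => h (hw'.2 v h')
  exact hv (by simp [h1, h2])

theorem smul_mem_weights {l : List V} {w : V →₀ ℝ} (hw : w ∈ Weights l) {a : ℝ} (ha : 0 ≤ a) :
    a • w ∈ Weights l :=
  ⟨fun v => mul_nonneg ha (hw.1 v), fun v hv => hw.2 v fun h => hv (by simp [h])⟩

theorem pos_mem_cone {pos : V → E} {L : List (List V)} {l : List V} (hl : l ∈ L) {v : V}
    (hv : v ∈ l) : pos v ∈ cone pos L := by
  classical
  exact ⟨l, hl, _, single_mem_weights hv zero_le_one, by simp [bary]⟩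

theorem bary_nonneg {f : V → ℝ} {l : List V} {w : V →₀ ℝ} (hw : w ∈ Weights l)
    (hf : ∀ v ∈ l, 0 ≤ f v) : 0 ≤ bary f w := by
  rw [bary, Finsupp.linearCombination_apply]
  refine Finset.sum_nonneg fun v hv => mul_nonneg (hw.1 v) (hf v (hw.2 v ?_))
  simpa using hv

theorem bary_add {f g : V → ℝ} (w : V →₀ ℝ) :
    bary (fun v => f v + g v) w = bary f w + bary g w := by
  simp [bary, Finsupp.linearCombination_apply, Finsupp.sum, mul_add, Finset.sum_add_distrib]

theorem bary_neg {f : V → ℝ} (w : V →₀ ℝ) : bary (fun v => - f v) w = - bary f w := by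
  simp [bary, Finsupp.linearCombination_apply, Finsupp.sum]

theorem bary_congr {f g : V → E} {l : List V} {w : V →₀ ℝ} (hw : w ∈ Weights l)
    (h : ∀ v ∈ l, f v = g v) : bary f w = bary g w := by
  rw [bary, bary, Finsupp.linearCombination_apply, Finsupp.linearCombination_apply]
  refine Finset.sum_congr rfl fun v hv => ?_
  simp only [h v (hw.2 v (by simpa using hv))]

theorem LinearOn.add {pos : V → E} {L : List (List V)} {F G : E → ℝ} (hF : LinearOn pos L F)
    (hG : LinearOn pos L G) : LinearOn pos L (fun x => F x + G x) := fun l hl w hw => by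
  simp only [bary_add, hF l hl w hw, hG l hl w hw]

theorem LinearOn.neg {pos : V → E} {L : List (List V)} {F : E → ℝ} (hF : LinearOn pos L F) :
    LinearOn pos L (fun x => - F x) := fun l hl w hw => by
  simp only [bary_neg, hF l hl w hw]

theorem LinearOn.sub {pos : V → E} {L : List (List V)} {F G : E → ℝ} (hF : LinearOn pos L F)
    (hG : LinearOn pos L G) : LinearOn pos L (fun x => F x - G x) := by
  simpa [sub_eq_add_neg] using hF.add hG.neg

theorem linearOn_linearMap {pos : V → E} {L : List (List V)} (F : E →ₗ[ℝ] ℝ) :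
    LinearOn pos L F := fun l _ w _ => by
  simp [bary, Finsupp.linearCombination_apply, Finsupp.sum, map_sum]

omit [AddCommGroup E] [Module ℝ E] in
theorem SignedOn.neg {pos : V → E} {L : List (List V)} {F : E → ℝ} (hF : SignedOn pos L F) :
    SignedOn pos L (fun x => - F x) := fun l hl p hp q hq h1 h2 =>
  hF l hl q hq p hp (by linarith) (by linarith)

omit [AddCommGroup E] [Module ℝ E] in
theorem SignedOn.nonneg_or_nonpos {pos : V → E} {L : List (List V)} {F : E → ℝ}
    (hF : SignedOn pos L F) {l : List V} (hl : l ∈ L) :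
    (∀ v ∈ l, 0 ≤ F (pos v)) ∨ ∀ v ∈ l, F (pos v) ≤ 0 := by
  by_contra! h
  obtain ⟨⟨p, hp, hp'⟩, q, hq, hq'⟩ := h
  exact hF l hl p hp q hq hp' hq'

/-- The minimum with a linear function is linear where the difference has constant sign. -/
theorem LinearOn.min {pos : V → E} {L : List (List V)} {F G : E → ℝ} (hF : LinearOn pos L F)
    (hG : LinearOn pos L G) (hs : SignedOn pos L (fun x => G x - F x)) :
    LinearOn pos L (fun x => min (F x) (G x)) := fun l hl w hw => by
  have hd := (hG.sub hF) l hl w hw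
  simp only
  rcases hs.nonneg_or_nonpos hl with h | h
  · have := bary_nonneg hw h
    rw [min_eq_left (by linarith), hF l hl w hw]
    exact bary_congr hw fun v hv => (min_eq_left (by linarith [h v hv])).symm
  · have := bary_nonneg (f := fun v => - (G (pos v) - F (pos v))) hw
      fun v hv => by linarith [h v hv]
    rw [bary_neg] at this
    rw [min_eq_right (by linarith), hG l hl w hw]
    exact bary_congr hw fun v hv => (min_eq_right (by linarith [h v hv])).symm

/-! #### Restriction to the vertices satisfying some inequalities -/

theorem weights_mono {l m : List V} (h : ∀ v ∈ l, v ∈ m) : Weights l ⊆ Weights m :=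
  fun _ hw => ⟨hw.1, fun v hv => h v (hw.2 v hv)⟩

section Restrict

variable {pos : V → E} {L : List (List V)} (P : V → Bool)

theorem Embedded.restrict (h : Embedded pos L) : Embedded pos (L.map (List.filter P)) := by
  intro l hl m hm w hw w' hw'
  obtain ⟨l, hl', rfl⟩ := List.mem_map.1 hl
  obtain ⟨m, hm', rfl⟩ := List.mem_map.1 hm
  exact h l hl' m hm' w (weights_mono (fun v hv => (List.mem_filter.1 hv).1) hw) w'
    (weights_mono (fun v hv => (List.mem_filter.1 hv).1) hw')

theorem nodup_restrict (h : ∀ l ∈ L, l.Nodup) : ∀ l ∈ L.map (List.filter P), l.Nodup := by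
  intro l hl
  obtain ⟨l, hl', rfl⟩ := List.mem_map.1 hl
  exact (h l hl').filter _

/-- On a cell where `F i` is nonnegative, a point with `F i ≤ 0` can put no weight on a vertex with
`F i > 0`; on a cell where it is nonpositive there is no such vertex. So deleting the bad vertices
loses no admissible point. -/
theorem cone_restrict {ι : Type*} {F : ι → E → ℝ} (hF : ∀ i, LinearOn pos L (F i))
    (hs : ∀ i, SignedOn pos L (F i)) (hP : ∀ v, v ∈ L.flatten → (P v ↔ ∀ i, F i (pos v) ≤ 0)) :
    cone pos (L.map (List.filter P)) = {x ∈ cone pos L | ∀ i, F i x ≤ 0} := by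
  ext x
  constructor
  · rintro ⟨l', hl', w, hw, rfl⟩
    obtain ⟨l, hl, rfl⟩ := List.mem_map.1 hl'
    have hw' : w ∈ Weights l := weights_mono (fun v hv => (List.mem_filter.1 hv).1) hw
    refine ⟨⟨l, hl, w, hw', rfl⟩, fun i => ?_⟩
    rw [hF i l hl w hw']
    have := bary_nonneg (f := fun v => - F i (pos v)) hw fun v hv => by
      have h1 := List.mem_filter.1 hv
      have := (hP v (List.mem_flatten.2 ⟨l, hl, h1.1⟩)).1 h1.2 i
      linarith
    rw [bary_neg] at this
    linarith
  · rintro ⟨⟨l, hl, w, hw, rfl⟩, h⟩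
    refine ⟨_, List.mem_map_of_mem hl, w, ⟨hw.1, fun v hv => ?_⟩, rfl⟩
    have hvl := hw.2 v hv
    refine List.mem_filter.2 ⟨hvl, (hP v (List.mem_flatten.2 ⟨l, hl, hvl⟩)).2 fun i => ?_⟩
    by_contra! hpos
    rcases (hs i).nonneg_or_nonpos hl with h1 | h1
    · have h2 := h i
      rw [hF i l hl w hw, bary, Finsupp.linearCombination_apply] at h2
      have h3 : 0 < w.sum fun v a => a • F i (pos v) := by
        refine Finset.sum_pos' (fun u hu => mul_nonneg (hw.1 u) (h1 u (hw.2 u (by simpa using hu))))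
          ⟨v, by simpa using hv, mul_pos (lt_of_le_of_ne (hw.1 v) (Ne.symm hv)) hpos⟩
      linarith
    · linarith [h1 v hvl]

theorem LinearOn.restrict {F : E → ℝ} (h : LinearOn pos L F) :
    LinearOn pos (L.map (List.filter P)) F := by
  intro l hl w hw
  obtain ⟨l, hl', rfl⟩ := List.mem_map.1 hl
  exact h l hl' w (weights_mono (fun v hv => (List.mem_filter.1 hv).1) hw)

end Restrict

/-! #### Stellar subdivision of an edge -/

section Stellar

variable [DecidableEq V]

/-- Replace a vertex of a cell by another one. -/
def replace (p c : V) (l : List V) : List V := l.map fun v => if v = p then c else v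

/-- Stellar subdivision of the edge `pq` at `c`. -/
def stellar (p q c : V) (L : List (List V)) : List (List V) :=
  L.flatMap fun l => if p ∈ l ∧ q ∈ l then [replace p c l, replace q c l] else [l]

theorem mem_replace {p c v : V} {l : List V} (hp : p ∈ l) :
    v ∈ replace p c l ↔ v = c ∨ (v ∈ l ∧ v ≠ p) := by
  simp only [replace, List.mem_map]
  constructor
  · rintro ⟨u, hu, rfl⟩
    split_ifs with h
    · exact Or.inl rfl
    · exact Or.inr ⟨hu, h⟩
  · rintro (rfl | ⟨h1, h2⟩)
    · exact ⟨p, hp, by simp⟩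
    · exact ⟨v, h1, by simp [h2]⟩

theorem mem_stellar {p q c : V} {L : List (List V)} {m : List V} :
    m ∈ stellar p q c L ↔ (m ∈ L ∧ ¬ (p ∈ m ∧ q ∈ m)) ∨
      ∃ l ∈ L, p ∈ l ∧ q ∈ l ∧ (m = replace p c l ∨ m = replace q c l) := by
  simp only [stellar, List.mem_flatMap]
  constructor
  · rintro ⟨l, hl, h⟩
    split_ifs at h with hpq
    · exact Or.inr ⟨l, hl, hpq.1, hpq.2, by simpa using h⟩
    · rw [List.mem_singleton] at h
      exact Or.inl ⟨h ▸ hl, h ▸ hpq⟩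
  · rintro (⟨h1, h2⟩ | ⟨l, hl, hp, hq, h⟩)
    · exact ⟨m, h1, by simp [h2]⟩
    · exact ⟨l, hl, by simp [hp, hq, h]⟩

theorem nodup_replace {p c : V} {l : List V} (h : l.Nodup) (hc : c ∉ l) :
    (replace p c l).Nodup := by
  refine List.Nodup.map_on (fun x hx y hy hxy => ?_) h
  split_ifs at hxy with h1 h2 h2
  · rw [h1, h2]
  · exact absurd (hxy ▸ hy) hc
  · exact absurd (hxy ▸ hx) hc
  · exact hxy

variable {pos : V → E} {L : List (List V)} {p q c : V} {α β : ℝ}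

/-- The weights on the original cell that correspond to weights on a subdivided cell. -/
noncomputable def push (p q c : V) (α β : ℝ) (w : V →₀ ℝ) : V →₀ ℝ :=
  w + w c • (Finsupp.single p α + Finsupp.single q β - Finsupp.single c 1)

omit [DecidableEq V] in
theorem bary_push (hc : pos c = α • pos p + β • pos q) (w : V →₀ ℝ) :
    bary pos (push p q c α β w) = bary pos w := by
  simp [push, bary, map_add, map_sub, hc]

/-- Redistributing the weight of `c` to `p` and `q` returns to an original cell. The alternative `w
p = 0 ∨ w q = 0`, true because no new cell contains both ends of the edge, is what makes this
reversible. -/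
theorem push_mem (hα : 0 < α) (hβ : 0 < β) (hpc : p ≠ c) (hqc : q ≠ c)
    (hL : ∀ l ∈ L, c ∉ l) {m : List V}
    (hm : m ∈ stellar p q c L) {w : V →₀ ℝ} (hw : w ∈ Weights m) :
    (∃ l ∈ L, push p q c α β w ∈ Weights l ∧ (w c ≠ 0 → p ∈ l ∧ q ∈ l)) ∧ (w p = 0 ∨ w q = 0) := by
  rcases mem_stellar.1 hm with ⟨h1, h2⟩ | ⟨l, hl, hp, hq, h⟩
  · have hc0 : w c = 0 := by_contra fun h => hL m h1 (hw.2 c h)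
    refine ⟨⟨m, h1, by simpa [push, hc0] using hw, fun h => absurd hc0 h⟩, ?_⟩
    by_contra! h
    exact h2 ⟨hw.2 p h.1, hw.2 q h.2⟩
  · have key : ∀ v, w v ≠ 0 → v = c ∨ v ∈ l := by
      intro v hv
      have := hw.2 v hv
      rcases h with rfl | rfl
      · exact ((mem_replace hp).1 this).imp_right And.left
      · exact ((mem_replace hq).1 this).imp_right And.left
    refine ⟨⟨l, hl, ⟨fun v => ?_, fun v hv => ?_⟩, fun _ => ⟨hp, hq⟩⟩, ?_⟩
    · have h0 := hw.1 v
      have h1 := hw.1 c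
      by_cases hvc : v = c
      · subst hvc
        simp [push, hpc, hqc]
      · have : 0 ≤ w c * ((if p = v then α else 0) + if q = v then β else 0) := by
          refine mul_nonneg h1 (add_nonneg ?_ ?_) <;> split_ifs <;> linarith
        simp only [push, Finsupp.add_apply, Finsupp.smul_apply, Finsupp.sub_apply,
          Finsupp.single_apply, if_neg (Ne.symm hvc), smul_eq_mul, sub_zero]
        linarith
    · by_cases hvc : v = c
      · subst hvc
        exact absurd (by simp [push, hpc, hqc]) hv
      by_cases hvp : p = v
      · exact hvp ▸ hp
      by_cases hvq : q = v
      · exact hvq ▸ hq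
      refine (key v fun h0 => hv ?_).resolve_left hvc
      simp [push, hvp, hvq, Ne.symm hvc, h0]
    · rcases h with rfl | rfl
      · refine Or.inl (by_contra fun h => ?_)
        rcases (mem_replace hp).1 (hw.2 p h) with h | h
        · exact hpc h
        · exact h.2 rfl
      · refine Or.inr (by_contra fun h => ?_)
        rcases (mem_replace hq).1 (hw.2 q h) with h | h
        · exact hqc h
        · exact h.2 rfl

/-- The weight at `c` is recovered as the smaller of the pushed weights at `p` and `q` divided by α
and β; the other weights follow. -/
theorem push_inj (hα : 0 < α) (hβ : 0 < β) (hpq : p ≠ q) (hpc : p ≠ c) (hqc : q ≠ c)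
    {w w' : V →₀ ℝ} (hw : ∀ v, 0 ≤ w v) (hw' : ∀ v, 0 ≤ w' v) (h0 : w p = 0 ∨ w q = 0)
    (h0' : w' p = 0 ∨ w' q = 0) (h : push p q c α β w = push p q c α β w') : w = w' := by
  have hp := DFunLike.congr_fun h p
  have hq := DFunLike.congr_fun h q
  simp only [push, Finsupp.add_apply, Finsupp.smul_apply, Finsupp.sub_apply,
    Finsupp.single_apply, if_neg hpq.symm, if_neg hpc.symm, if_neg hqc.symm, smul_eq_mul, if_true,
    if_neg hpq, add_zero, zero_add, sub_zero] at hp hq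
  have hc : w c = w' c := by
    rcases lt_trichotomy (w c) (w' c) with hlt | heq | hlt
    · have h1 := mul_lt_mul_of_pos_right hlt hα
      have h2 := mul_lt_mul_of_pos_right hlt hβ
      rcases h0 with h | h
      · linarith [hw' p]
      · linarith [hw' q]
    · exact heq
    · have h1 := mul_lt_mul_of_pos_right hlt hα
      have h2 := mul_lt_mul_of_pos_right hlt hβ
      rcases h0' with h | h
      · linarith [hw p]
      · linarith [hw q]
  unfold push at h
  rw [hc] at h
  exact add_right_cancel h

/-- The point of `c` has positive weights at both `p` and `q`, so by injectivity it is not itself a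
vertex. -/
theorem Embedded.notMem (hL : Embedded pos L) (hα : 0 < α) (hβ : 0 < β) (hpq : p ≠ q)
    (hc : pos c = α • pos p + β • pos q) {l : List V} (hl : l ∈ L) (hp : p ∈ l) (hq : q ∈ l) :
    ∀ m ∈ L, c ∉ m := by
  intro m hm hcm
  have h := hL m hm l hl _ (single_mem_weights hcm zero_le_one) _
    (add_mem_weights (single_mem_weights hp hα.le) (single_mem_weights hq hβ.le))
    (by simp [bary, hc])
  have h1 := DFunLike.congr_fun h p
  have h2 := DFunLike.congr_fun h q
  simp only [Finsupp.single_apply, Finsupp.add_apply, if_true, if_neg hpq, if_neg hpq.symm,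
    add_zero, zero_add] at h1 h2
  split_ifs at h1 h2 with h3 h4 h4
  · exact hpq (h3.symm.trans h4)
  all_goals linarith

/-- Everything is transported along `push`, which identifies weights on new cells with weights on
old ones without moving the point. -/
theorem Refines.stellar (hL : Embedded pos L) (hn : ∀ l ∈ L, l.Nodup) (hα : 0 < α) (hβ : 0 < β)
    (hpq : p ≠ q) (hc : pos c = α • pos p + β • pos q) : Refines pos L (stellar p q c L) := by
  by_cases hex : ∃ l ∈ L, p ∈ l ∧ q ∈ l
  swap
  · have : ConeComplex.stellar p q c L = L := by
      push Not at hex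
      rw [ConeComplex.stellar]
      conv_rhs => rw [← List.flatMap_singleton' L]
      rw [List.flatMap_def, List.flatMap_def]
      congr 1
      refine List.map_congr_left fun l hl => ?_
      rw [if_neg fun h => hex l hl h.1 h.2]
    rw [this]
    exact Refines.refl hL hn
  obtain ⟨l₀, hl₀, hp₀, hq₀⟩ := hex
  have hcL := hL.notMem hα hβ hpq hc hl₀ hp₀ hq₀
  have hpc : p ≠ c := fun h => hcL l₀ hl₀ (h ▸ hp₀)
  have hqc : q ≠ c := fun h => hcL l₀ hl₀ (h ▸ hq₀)
  have hval : ∀ F, LinearOn pos L F → ∀ l ∈ L, p ∈ l → q ∈ l →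
      F (pos c) = α * F (pos p) + β * F (pos q) := by
    intro F hF l hl hp hq
    have := hF l hl _
      (add_mem_weights (single_mem_weights hp hα.le) (single_mem_weights hq hβ.le))
    simpa [bary, hc] using this
  refine ⟨?_, ?_, ?_, ?_, ?_⟩
  · intro m hm m' hm' w hw w' hw' h
    obtain ⟨⟨l, hl, hwl, -⟩, h0⟩ := push_mem hα hβ hpc hqc hcL hm hw
    obtain ⟨⟨l', hl', hwl', -⟩, h0'⟩ := push_mem hα hβ hpc hqc hcL hm' hw'
    refine push_inj hα hβ hpq hpc hqc hw.1 hw'.1 h0 h0' (hL l hl l' hl' _ hwl _ hwl' ?_)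
    rw [bary_push hc, bary_push hc, h]
  · intro m hm
    rcases mem_stellar.1 hm with ⟨h1, -⟩ | ⟨l, hl, -, -, rfl | rfl⟩
    · exact hn m h1
    · exact nodup_replace (hn l hl) (hcL l hl)
    · exact nodup_replace (hn l hl) (hcL l hl)
  · ext x
    constructor
    · rintro ⟨m, hm, w, hw, rfl⟩
      obtain ⟨⟨l, hl, hwl, -⟩, -⟩ := push_mem hα hβ hpc hqc hcL hm hw
      exact ⟨l, hl, _, hwl, bary_push hc w⟩
    · rintro ⟨l, hl, w, hw, rfl⟩
      by_cases hpl : p ∈ l ∧ q ∈ l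
      swap
      · exact ⟨l, mem_stellar.2 (Or.inl ⟨hl, hpl⟩), w, hw, rfl⟩
      obtain ⟨hp, hq⟩ := hpl
      have hwc : w c = 0 := by_contra fun h => hcL l hl (hw.2 c h)
      -- The inverse of `push`: move as much weight as possible to `c`. The largest τ is the minimum
      -- of `w p / α` and `w q / β`; the end `r` where it is attained loses all its weight and can
      -- be replaced by `c`.
      have key : ∀ τ : ℝ, 0 ≤ τ → τ * α ≤ w p → τ * β ≤ w q → ∀ r, (r = p ∨ r = q) →
          (r = p → τ * α = w p) → (r = q → τ * β = w q) →
          (w - τ • (Finsupp.single p α + Finsupp.single q β - Finsupp.single c 1)) ∈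
            Weights (replace r c l) := by
        intro τ hτ h1 h2 r hr hr1 hr2
        have hrl : r ∈ l := by rcases hr with rfl | rfl <;> assumption
        have e : ∀ v, (w - τ • (Finsupp.single p α + Finsupp.single q β - Finsupp.single c 1) :
            V →₀ ℝ) v
            = w v - τ * (((if p = v then α else 0) + if q = v then β else 0)
              - if c = v then 1 else 0) := by
          intro v
          simp [Finsupp.single_apply]
        refine ⟨fun v => ?_, fun v hv => (mem_replace hrl).2 ?_⟩
        · rw [e]
          have h0 := hw.1 v
          by_cases hv1 : p = v
          · subst hv1
            simp only [if_true, if_neg hpq.symm, if_neg hpc.symm]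
            linarith
          by_cases hv2 : q = v
          · subst hv2
            simp only [if_true, if_neg hpq, if_neg hqc.symm]
            linarith
          by_cases hv3 : c = v
          · subst hv3
            simp only [if_true, if_neg hpc, if_neg hqc]
            linarith
          simp [hv1, hv2, hv3, h0]
        · by_cases hv3 : v = c
          · exact Or.inl hv3
          refine Or.inr ⟨?_, ?_⟩
          · by_cases hv1 : p = v
            · exact hv1 ▸ hp
            by_cases hv2 : q = v
            · exact hv2 ▸ hq
            refine hw.2 v fun h0 => hv ?_
            rw [e]
            simp [hv1, hv2, Ne.symm hv3, h0]
          · rintro rfl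
            apply hv
            rw [e]
            rcases hr with rfl | rfl
            · simp only [if_true, if_neg hpq.symm, if_neg hpc.symm]
              linarith [hr1 rfl]
            · simp only [if_true, if_neg hpq, if_neg hqc.symm]
              linarith [hr2 rfl]
      have e2 : ∀ τ : ℝ, bary pos (w - τ • (Finsupp.single p α + Finsupp.single q β
          - Finsupp.single c 1)) = bary pos w := by
        intro τ
        simp [bary, map_sub, map_add, hc]
      rcases le_total (w p / α) (w q / β) with h | h
      · refine ⟨_, mem_stellar.2 (Or.inr ⟨l, hl, hp, hq, Or.inl rfl⟩), _,
          key (w p / α) (div_nonneg (hw.1 p) hα.le) (div_mul_cancel₀ _ hα.ne').le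
            ((le_div_iff₀ hβ).1 h) p (Or.inl rfl) (fun _ => div_mul_cancel₀ _ hα.ne')
            (fun h => absurd h hpq), e2 _⟩
      · refine ⟨_, mem_stellar.2 (Or.inr ⟨l, hl, hp, hq, Or.inr rfl⟩), _,
          key (w q / β) (div_nonneg (hw.1 q) hβ.le) ((le_div_iff₀ hα).1 h)
            (div_mul_cancel₀ _ hβ.ne').le q (Or.inr rfl) (fun h => absurd h hpq.symm)
            (fun _ => div_mul_cancel₀ _ hβ.ne'), e2 _⟩
  · intro F hF m hm w hw
    obtain ⟨⟨l, hl, hwl, hcl⟩, -⟩ := push_mem hα hβ hpc hqc hcL hm hw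
    rw [← bary_push hc, hF l hl _ hwl]
    by_cases h0 : w c = 0
    · simp [push, h0]
    · obtain ⟨hp, hq⟩ := hcl h0
      exact bary_push (pos := fun v => F (pos v)) (hval F hF l hl hp hq) w
  · intro F hF hs m hm
    rcases mem_stellar.1 hm with ⟨h1, -⟩ | ⟨l, hl, hp, hq, h⟩
    · exact hs m h1
    have key : ∀ v ∈ m, v = c ∨ v ∈ l := by
      intro v hv
      rcases h with rfl | rfl
      · exact ((mem_replace hp).1 hv).imp_right And.left
      · exact ((mem_replace hq).1 hv).imp_right And.left
    have hcv := hval F hF l hl hp hq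
    intro u hu v hv h1 h2
    rcases hs.nonneg_or_nonpos hl with hF0 | hF0
    · have : 0 ≤ F (pos u) := by
        rcases key u hu with rfl | hu
        · rw [hcv]
          have := hF0 p hp
          have := hF0 q hq
          positivity
        · exact hF0 u hu
      linarith
    · have : F (pos v) ≤ 0 := by
        rcases key v hv with rfl | hv
        · rw [hcv]
          nlinarith [hF0 p hp, hF0 q hq]
        · exact hF0 v hv
      linarith

/-- Subdivide all the edges between the given pairs of vertices that satisfy `cross`. -/
def cutPairs (cross : V → V → Bool) (mid : V → V → V) (P : List (V × V)) (L : List (List V)) :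
    List (List V) :=
  P.foldl (fun M e => if cross e.1 e.2 then stellar e.1 e.2 (mid e.1 e.2) M else M) L

/-- Subdivide all the edges that satisfy `cross`. -/
def cut (cross : V → V → Bool) (mid : V → V → V) (L : List (List V)) : List (List V) :=
  cutPairs cross mid (L.flatten.flatMap fun p => L.flatten.map fun q => (p, q)) L

/-- Each new vertex is a zero of `F`, so a cut creates no new edge along which `F` changes sign, and
an edge once removed does not return. One pass over the pairs suffices. -/
theorem cutPairs_spec {cross : V → V → Bool} {mid : V → V → V} {F : E → ℝ}
    (P : List (V × V)) (hcross : ∀ e ∈ P, cross e.1 e.2 ↔ F (pos e.1) < 0 ∧ 0 < F (pos e.2))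
    (hmid : ∀ e ∈ P, cross e.1 e.2 →
      pos (mid e.1 e.2) = F (pos e.2) • pos e.1 + (- F (pos e.1)) • pos e.2)
    (L : List (List V)) (hL : Embedded pos L) (hn : ∀ l ∈ L, l.Nodup)
    (hF : LinearOn pos L F) :
    Refines pos L (cutPairs cross mid P L) ∧
      ∀ m ∈ cutPairs cross mid P L, ∃ l ∈ L, (∀ v ∈ m, v ∈ l ∨ F (pos v) = 0) ∧
        ∀ e ∈ P, cross e.1 e.2 → e.1 ∈ m → e.2 ∉ m := by
  induction P generalizing L with
  | nil => exact ⟨Refines.refl hL hn, fun m hm => ⟨m, hm, fun v hv => Or.inl hv, by simp⟩⟩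
  | cons e P ih =>
    have heP := List.mem_cons_self (a := e) (l := P)
    replace ih := ih (fun e' h => hcross e' (List.mem_cons_of_mem _ h))
      (fun e' h => hmid e' (List.mem_cons_of_mem _ h))
    rw [cutPairs, List.foldl_cons]
    by_cases he : cross e.1 e.2 = true
    swap
    · rw [if_neg he]
      obtain ⟨h1, h2⟩ := ih L hL hn hF
      refine ⟨h1, fun m hm => ?_⟩
      obtain ⟨l, hl, h3, h4⟩ := h2 m hm
      refine ⟨l, hl, h3, fun e' he' => ?_⟩
      rcases List.mem_cons.1 he' with rfl | he'
      · exact fun h => absurd h he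
      · exact h4 e' he'
    rw [if_pos he]
    have hneg := (hcross e heP).1 he
    have hne : e.1 ≠ e.2 := fun h => by rw [h] at hneg; linarith
    have hs := Refines.stellar hL hn hneg.2 (neg_pos.2 hneg.1) hne (hmid e heP he)
    obtain ⟨h1, h2⟩ := ih _ hs.embedded hs.nodup (hs.linearOn F hF)
    refine ⟨hs.trans h1, fun m hm => ?_⟩
    obtain ⟨l', hl', h3, h4⟩ := h2 m hm
    have key : ∃ l ∈ L, (∀ v ∈ l', v ∈ l ∨ F (pos v) = 0) ∧ (e.1 ∈ l' → e.2 ∉ l') := by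
      rcases mem_stellar.1 hl' with ⟨h5, h6⟩ | ⟨l, hl, hp, hq, h⟩
      · exact ⟨l', h5, fun v hv => Or.inl hv, fun h h' => h6 ⟨h, h'⟩⟩
      -- With weights F(q) and -F(p) at p and q, the two contributions to F cancel.
      have hc0 : F (pos (mid e.1 e.2)) = 0 := by
        have := hF l hl _ (add_mem_weights (single_mem_weights hp hneg.2.le)
          (single_mem_weights hq (neg_pos.2 hneg.1).le))
        rw [hmid e heP he]
        simp only [bary, map_add, Finsupp.linearCombination_single, smul_eq_mul] at this
        rw [this]
        ring
      refine ⟨l, hl, fun v hv => ?_, ?_⟩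
      · rcases h with rfl | rfl
        · rcases (mem_replace hp).1 hv with rfl | h
          · exact Or.inr hc0
          · exact Or.inl h.1
        · rcases (mem_replace hq).1 hv with rfl | h
          · exact Or.inr hc0
          · exact Or.inl h.1
      · intro h1 h2
        rcases h with rfl | rfl
        · rcases (mem_replace hp).1 h1 with h | h
          · rw [← h] at hc0; linarith
          · exact h.2 rfl
        · rcases (mem_replace hq).1 h2 with h | h
          · rw [← h] at hc0; linarith
          · exact h.2 rfl
    obtain ⟨l, hl, h5, h6⟩ := key
    refine ⟨l, hl, fun v hv => ?_, fun e' he' hcr h7 h8 => ?_⟩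
    · rcases h3 v hv with h | h
      · exact h5 v h
      · exact Or.inr h
    · rcases List.mem_cons.1 he' with rfl | he'
      · refine h6 ((h3 _ h7).resolve_right ?_) ((h3 _ h8).resolve_right ?_) <;> linarith
      · exact h4 e' he' hcr h7 h8

theorem cut_spec {cross : V → V → Bool} {mid : V → V → V} {F : E → ℝ}
    {L : List (List V)} (hcross : ∀ p ∈ L.flatten, ∀ q ∈ L.flatten,
      cross p q ↔ F (pos p) < 0 ∧ 0 < F (pos q))
    (hmid : ∀ p ∈ L.flatten, ∀ q ∈ L.flatten, cross p q →
      pos (mid p q) = F (pos q) • pos p + (- F (pos p)) • pos q) (hL : Embedded pos L) (hn : ∀ l ∈ L, l.Nodup) (hF : LinearOn pos L F) :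
    Refines pos L (cut cross mid L) ∧ SignedOn pos (cut cross mid L) F := by
  have hP : ∀ e : V × V, e ∈ (L.flatten.flatMap fun p => L.flatten.map fun q => (p, q)) ↔
      e.1 ∈ L.flatten ∧ e.2 ∈ L.flatten := by
    intro e
    simp only [List.mem_flatMap, List.mem_map]
    exact ⟨by rintro ⟨p, hp, q, hq, rfl⟩; exact ⟨hp, hq⟩, fun h => ⟨_, h.1, _, h.2, rfl⟩⟩
  obtain ⟨h1, h2⟩ := cutPairs_spec (F := F) _ (fun e he => hcross _ ((hP e).1 he).1 _ ((hP e).1 he).2)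
    (fun e he => hmid _ ((hP e).1 he).1 _ ((hP e).1 he).2) L hL hn hF
  refine ⟨h1, fun m hm p hp q hq hp0 hq0 => ?_⟩
  obtain ⟨l, hl, h3, h4⟩ := h2 m hm
  -- Vertices with nonzero `F` are old ones, so the pair (p, q) was among those processed.
  have hpL := List.mem_flatten.2 ⟨l, hl, (h3 p hp).resolve_right hp0.ne⟩
  have hqL := List.mem_flatten.2 ⟨l, hl, (h3 q hq).resolve_right hq0.ne'⟩
  exact h4 (p, q) ((hP _).2 ⟨hpL, hqL⟩) ((hcross p hpL q hqL).2 ⟨hp0, hq0⟩) hp hq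

end Stellar

end ConeComplex

/-! ### Primitive recursion on terms -/

namespace MVTerm

theorem primrec_toNat : Primrec toNat := Primrec.of_equiv (e := equivNat.symm.symm)

theorem primrec_ofNat : Primrec ofNat := Primrec.of_equiv_symm (e := equivNat)

theorem primrec_neg : Primrec neg := by
  have : Primrec fun s => ofNat (3 * toNat s + 2) :=
    primrec_ofNat.comp (Primrec.nat_add.comp
      (Primrec.nat_mul.comp (Primrec.const 3) primrec_toNat) (Primrec.const 2))
  exact this.of_eq fun s => ofNat_toNat (neg s)

theorem primrec_oplus : Primrec₂ oplus := by
  have : Primrec fun s : MVTerm × MVTerm =>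
      ofNat (3 * Nat.pair (toNat s.1) (toNat s.2) + 3) :=
    primrec_ofNat.comp (Primrec.nat_add.comp
      (Primrec.nat_mul.comp (Primrec.const 3) (Primrec₂.natPair.comp
        (primrec_toNat.comp Primrec.fst) (primrec_toNat.comp Primrec.snd))) (Primrec.const 3))
  exact this.of_eq fun s => ofNat_toNat (oplus s.1 s.2)

/-- Functions defined by structural recursion on terms are primitive recursive. -/
theorem primrec_recursion {α β : Type*} [Primcodable α] [Primcodable β] (f : α → MVTerm → β)
    (hz : Primrec fun a => f a zero) (hv : Primrec₂ fun a i => f a (var i))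
    {gn : α → β → β} (hgn : Primrec₂ gn) (hn : ∀ a s, f a (neg s) = gn a (f a s))
    {go : α → (MVTerm × β) × (MVTerm × β) → β} (hgo : Primrec₂ go)
    (ho : ∀ a s u, f a (oplus s u) = go a ((s, f a s), (u, f a u))) : Primrec₂ f := by
  -- Course-of-values recursion on Gödel numbers: `ih` lists the values at all smaller numbers, so
  -- its length is the number being treated, and subterms are looked up in it. The cases modulo 3
  -- mirror `ofNat`.
  let g : α → List β → Option β := fun a ih =>
    if ih.length = 0 then some (f a zero)
    else if (ih.length - 1) % 3 = 0 then some (f a (var ((ih.length - 1) / 3)))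
    else if (ih.length - 1) % 3 = 1 then (ih[(ih.length - 1) / 3]?).map (gn a)
    else (ih[(Nat.unpair ((ih.length - 1) / 3)).1]?).bind fun x =>
      (ih[(Nat.unpair ((ih.length - 1) / 3)).2]?).map fun y =>
        go a ((ofNat (Nat.unpair ((ih.length - 1) / 3)).1, x),
          (ofNat (Nat.unpair ((ih.length - 1) / 3)).2, y))
  have hlen : Primrec fun x : α × List β => x.2.length :=
    Primrec.list_length.comp Primrec.snd
  have hpred : Primrec fun x : α × List β => x.2.length - 1 :=
    Primrec.nat_sub.comp hlen (Primrec.const 1)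
  have hdiv : Primrec fun x : α × List β => (x.2.length - 1) / 3 :=
    Primrec.nat_div.comp hpred (Primrec.const 3)
  have hmod : Primrec fun x : α × List β => (x.2.length - 1) % 3 :=
    Primrec.nat_mod.comp hpred (Primrec.const 3)
  have hu1 : Primrec fun x : α × List β => (Nat.unpair ((x.2.length - 1) / 3)).1 :=
    Primrec.fst.comp (Primrec.unpair.comp hdiv)
  have hu2 : Primrec fun x : α × List β => (Nat.unpair ((x.2.length - 1) / 3)).2 :=
    Primrec.snd.comp (Primrec.unpair.comp hdiv)
  have hg : Primrec₂ g := by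
    refine Primrec.ite (Primrec.eq.comp hlen (Primrec.const 0))
      (Primrec.option_some.comp (hz.comp Primrec.fst)) ?_
    refine Primrec.ite (Primrec.eq.comp hmod (Primrec.const 0))
      (Primrec.option_some.comp (hv.comp Primrec.fst hdiv)) ?_
    refine Primrec.ite (Primrec.eq.comp hmod (Primrec.const 1))
      (Primrec.option_map (Primrec.list_getElem?.comp Primrec.snd hdiv)
        (hgn.comp (Primrec.fst.comp Primrec.fst) Primrec.snd)) ?_
    refine Primrec.option_bind (Primrec.list_getElem?.comp Primrec.snd hu1) ?_
    refine Primrec.option_map (Primrec.list_getElem?.comp (Primrec.snd.comp Primrec.fst)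
      (hu2.comp Primrec.fst)) ?_
    refine hgo.comp (Primrec.fst.comp (Primrec.fst.comp Primrec.fst)) ?_
    exact Primrec.pair
      (Primrec.pair (primrec_ofNat.comp (hu1.comp (Primrec.fst.comp Primrec.fst)))
        (Primrec.snd.comp Primrec.fst))
      (Primrec.pair (primrec_ofNat.comp (hu2.comp (Primrec.fst.comp Primrec.fst))) Primrec.snd)
  have key : Primrec₂ fun a k => f a (ofNat k) := by
    refine Primrec.nat_strong_rec _ hg fun a k => ?_
    have hget : ∀ j, j < k → ((List.range k).map fun k => f a (ofNat k))[j]? =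
        some (f a (ofNat j)) := fun j hj => by simp [hj]
    simp only [g, List.length_map, List.length_range]
    cases k with
    | zero => simp [ofNat]
    | succ m =>
      have h1 : m / 3 < m + 1 := by omega
      have h2 : (Nat.unpair (m / 3)).1 < m + 1 := lt_of_le_of_lt (Nat.unpair_left_le _) h1
      have h3 : (Nat.unpair (m / 3)).2 < m + 1 := lt_of_le_of_lt (Nat.unpair_right_le _) h1
      simp only [Nat.add_sub_cancel, Nat.add_eq_zero_iff, one_ne_zero, and_false, if_false]
      rw [hget _ h1, hget _ h2, hget _ h3, ofNat]
      split_ifs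
      · rfl
      · simp [hn]
      · simp [ho]
  exact (key.comp₂ Primrec₂.left (primrec_toNat.comp₂ Primrec₂.right)).of_eq fun a s => by
    simp [ofNat_toNat]

/-! ### The algorithm -/

/-- The pairs of summands in a term, inner ones first. -/
def sums : MVTerm → List (MVTerm × MVTerm)
  | zero => []
  | var _ => []
  | neg s => sums s
  | oplus s u => sums s ++ sums u ++ [(s, u)]

/-- The numerator of the value of a term at a rational point of the cube. -/
def evalCode (p : RatPointCode) : MVTerm → ℕ
  | zero => 0
  | var i => p.1.getD i 0
  | neg s => p.2 + 1 - evalCode p s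
  | oplus s u => min (p.2 + 1) (evalCode p s + evalCode p u)

/-- Substitution of terms for the variables. -/
def subst (t : List MVTerm) : MVTerm → MVTerm
  | zero => zero
  | var i => t.getD i zero
  | neg s => neg (subst t s)
  | oplus s u => oplus (subst t s) (subst t u)

/-! ### Primitive recursiveness of the operations on terms -/

theorem primrec_sums : Primrec sums := by
  have : Primrec₂ fun (_ : Unit) s => sums s := by
    refine primrec_recursion _ (Primrec.const _) (Primrec.const _)
      (gn := fun _ x => x) Primrec.snd (fun _ _ => rfl)
      (go := fun _ x => x.1.2 ++ x.2.2 ++ [(x.1.1, x.2.1)]) ?_ fun _ _ _ => rfl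
    have h : Primrec fun x : Unit × ((MVTerm × List (MVTerm × MVTerm)) ×
        (MVTerm × List (MVTerm × MVTerm))) => x.2 := Primrec.snd
    exact Primrec.list_append.comp (Primrec.list_append.comp
      (Primrec.snd.comp (Primrec.fst.comp h)) (Primrec.snd.comp (Primrec.snd.comp h)))
      (Primrec.list_cons.comp (Primrec.pair (Primrec.fst.comp (Primrec.fst.comp h))
        (Primrec.fst.comp (Primrec.snd.comp h))) (Primrec.const []))
  exact this.comp (Primrec.const ()) Primrec.id

theorem primrec_evalCode : Primrec₂ evalCode := by
  have hD : Primrec fun x : RatPointCode × ℕ => x.1.2 + 1 :=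
    Primrec.succ.comp (Primrec.snd.comp Primrec.fst)
  refine primrec_recursion _ (Primrec.const 0)
    ((Primrec.list_getD 0).comp (Primrec.fst.comp Primrec.fst) Primrec.snd)
    (gn := fun p x => p.2 + 1 - x) (Primrec.nat_sub.comp hD Primrec.snd) (fun _ _ => rfl)
    (go := fun p x => min (p.2 + 1) (x.1.2 + x.2.2)) ?_ fun _ _ _ => rfl
  exact Primrec.nat_min.comp (Primrec.succ.comp (Primrec.snd.comp Primrec.fst))
    (Primrec.nat_add.comp (Primrec.snd.comp (Primrec.fst.comp Primrec.snd))
      (Primrec.snd.comp (Primrec.snd.comp Primrec.snd)))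

theorem primrec_subst : Primrec₂ subst := by
  refine primrec_recursion _ (Primrec.const zero)
    ((Primrec.list_getD zero).comp Primrec.fst Primrec.snd)
    (gn := fun _ x => neg x) (primrec_neg.comp Primrec.snd) (fun _ _ => rfl)
    (go := fun _ x => oplus x.1.2 x.2.2) ?_ fun _ _ _ => rfl
  exact primrec_oplus.comp (Primrec.snd.comp (Primrec.fst.comp Primrec.snd))
    (Primrec.snd.comp (Primrec.snd.comp Primrec.snd))

instance decidableVarsBelow (n : ℕ) : DecidablePred (VarsBelow n)
  | zero => isTrue trivial
  | var i => inferInstanceAs (Decidable (i < n))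
  | neg s => decidableVarsBelow n s
  | oplus s u =>
    haveI := decidableVarsBelow n s
    haveI := decidableVarsBelow n u
    inferInstanceAs (Decidable (VarsBelow n s ∧ VarsBelow n u))

theorem primrec_varsBelow : PrimrecRel VarsBelow := by
  refine Primrec₂.primrecRel (primrec_recursion (fun n s => decide (VarsBelow n s))
    ((Primrec.const true).of_eq fun _ => (decide_eq_true (by trivial)).symm)
    (PrimrecRel.decide (PrimrecRel.swap Primrec.nat_lt))
    (gn := fun _ x => x) Primrec.snd (fun _ _ => rfl)
    (go := fun _ x => x.1.2 && x.2.2) ?_ fun _ _ _ => Bool.decide_and _ _)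
  exact Primrec.and.comp (Primrec.snd.comp (Primrec.fst.comp Primrec.snd))
    (Primrec.snd.comp (Primrec.snd.comp Primrec.snd))

end MVTerm

namespace ConeComplex

open MVTerm

theorem primrecRel_mem {α : Type*} [Primcodable α] : PrimrecRel fun (l : List α) a => a ∈ l :=
  (PrimrecRel.exists_mem_list Primrec.eq).of_eq fun l a => by simp

/-- Test whether the difference of two functions is negative at `p` and positive at `q`. -/
def crossCode (f : RatPointCode → ℕ × ℕ) (p q : RatPointCode) : Bool :=
  decide ((f p).1 < (f p).2) && decide ((f q).2 < (f q).1)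

/-- The zero of the difference of two functions on the edge `pq`. -/
def midCode (n : ℕ) (f : RatPointCode → ℕ × ℕ) (p q : RatPointCode) : RatPointCode :=
  ((List.range n).map fun i => ((f q).1 - (f q).2) * p.1.getD i 0 +
      ((f p).2 - (f p).1) * q.1.getD i 0,
    ((f q).1 - (f q).2) * (p.2 + 1) + ((f p).2 - (f p).1) * (q.2 + 1) - 1)

/-- Subdivide all the edges on which the difference of two functions changes its sign. -/
def cutCode (n : ℕ) (f : RatPointCode → ℕ × ℕ) (L : List (List RatPointCode)) :
    List (List RatPointCode) :=
  cut (crossCode f) (midCode n f) L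

/-- A simplex that contains the unit cube. -/
def simplexCode (n : ℕ) : List (List RatPointCode) :=
  [([], 0) :: (List.range n).map fun i => ((List.range n).map fun j => if j = i then n else 0, 0)]

/-- The condition for a rational point to be in the unit cube. -/
def InCube (n : ℕ) (p : RatPointCode) : Prop := ∀ i < n, p.1.getD i 0 ≤ p.2 + 1

instance (n : ℕ) : DecidablePred (InCube n) := fun _ => Nat.decidableBallLT _ _

/-- A triangulation of the unit cube. -/
def cubeCode (n : ℕ) : List (List RatPointCode) :=
  ((List.range n).foldl (fun L i => cutCode n (fun p => (p.1.getD i 0, p.2 + 1)) L)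
    (simplexCode n)).map (List.filter fun p => decide (InCube n p))

/-- Subdivide a triangulation such that the given terms become linear on every simplex. -/
def refineCode (n : ℕ) (ts : List MVTerm) (L : List (List RatPointCode)) :
    List (List RatPointCode) :=
  (ts.flatMap sums).foldl
    (fun L su => cutCode n (fun p => (evalCode p su.1 + evalCode p su.2, p.2 + 1)) L) L

/-- The condition for a rational point to be fixed by a list of terms. -/
def IsFixed (t : List MVTerm) (p : RatPointCode) : Prop :=
  ∀ i < t.length, evalCode p (t.getD i zero) = p.1.getD i 0

instance (t : List MVTerm) : DecidablePred (IsFixed t) := fun _ => Nat.decidableBallLT _ _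

/-- A triangulation of the cube such that the terms `t_i` and `t_i - X_i` are linear without change
of sign on every simplex. -/
def signedCode (t : List MVTerm) : List (List RatPointCode) :=
  (List.range t.length).foldl
    (fun L i => cutCode t.length (fun p => (evalCode p (t.getD i zero), p.1.getD i 0)) L)
    (refineCode t.length t (cubeCode t.length))

/-- Simplexes whose faces triangulate the set of the fixed points. -/
def fixedCode (t : List MVTerm) : List (List RatPointCode) :=
  (signedCode t).map (List.filter fun p => decide (IsFixed t p))

/-- The nonempty faces of the simplexes. -/
def facesCode (L : List (List RatPointCode)) : List (List RatPointCode) :=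
  L.flatMap fun l => l.sublists.filter fun m => decide (m ≠ [])

/-- All simplexes are faces of simplexes of dimension `n`. -/
def IsPure (n : ℕ) (T : List (List RatPointCode)) : Prop :=
  ∀ l ∈ T, ∃ m ∈ T, m.length = n + 1 ∧ ∀ v ∈ l, v ∈ m

/-- The condition on the vertices that makes the map given by `t` idempotent. -/
def IdempotentCode (t : List MVTerm) : Prop :=
  ∀ v ∈ (refineCode t.length (t ++ t.map (subst t)) (cubeCode t.length)).flatten,
    ∀ s ∈ t, evalCode v (subst t s) = evalCode v s

/-! ### Primitive recursiveness of the subdivision algorithm -/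

section Primrec

variable {α : Type*} [Primcodable α]

theorem primrec_replace {V : Type*} [Primcodable V] [DecidableEq V] {p c : α → V}
    {l : α → List V} (hp : Primrec p) (hc : Primrec c) (hl : Primrec l) :
    Primrec fun a => replace (p a) (c a) (l a) :=
  Primrec.list_map hl (Primrec.ite (Primrec.eq.comp Primrec.snd (hp.comp Primrec.fst))
    (hc.comp Primrec.fst) Primrec.snd)

theorem primrec_stellar {V : Type*} [Primcodable V] [DecidableEq V] {p q c : α → V}
    {L : α → List (List V)} (hp : Primrec p) (hq : Primrec q) (hc : Primrec c) (hL : Primrec L) :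
    Primrec fun a => stellar (p a) (q a) (c a) (L a) := by
  refine Primrec.list_flatMap hL (Primrec.ite ?_ ?_ ?_)
  · exact PrimrecPred.and (primrecRel_mem.comp Primrec.snd (hp.comp Primrec.fst))
      (primrecRel_mem.comp Primrec.snd (hq.comp Primrec.fst))
  · exact Primrec.list_cons.comp
      (primrec_replace (hp.comp Primrec.fst) (hc.comp Primrec.fst) Primrec.snd)
      (Primrec.list_cons.comp
        (primrec_replace (hq.comp Primrec.fst) (hc.comp Primrec.fst) Primrec.snd)
        (Primrec.const []))
  · exact Primrec.list_cons.comp Primrec.snd (Primrec.const [])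

theorem primrec_getD {p : α → RatPointCode} {i : α → ℕ} (hp : Primrec p) (hi : Primrec i) :
    Primrec fun a => (p a).1.getD (i a) 0 :=
  (Primrec.list_getD 0).comp (Primrec.fst.comp hp) hi

theorem primrec_midCode {n : α → ℕ} {f : α → RatPointCode → ℕ × ℕ} {p q : α → RatPointCode}
    (hn : Primrec n) (hf : Primrec₂ f) (hp : Primrec p) (hq : Primrec q) :
    Primrec fun a => midCode (n a) (f a) (p a) (q a) := by
  have h1 : Primrec fun a => (f a (q a)).1 - (f a (q a)).2 :=
    Primrec.nat_sub.comp (Primrec.fst.comp (hf.comp Primrec.id hq))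
      (Primrec.snd.comp (hf.comp Primrec.id hq))
  have h2 : Primrec fun a => (f a (p a)).2 - (f a (p a)).1 :=
    Primrec.nat_sub.comp (Primrec.snd.comp (hf.comp Primrec.id hp))
      (Primrec.fst.comp (hf.comp Primrec.id hp))
  refine Primrec.pair (Primrec.list_map (Primrec.list_range.comp hn) ?_) ?_
  · exact Primrec.nat_add.comp
      (Primrec.nat_mul.comp (h1.comp Primrec.fst)
        (primrec_getD (hp.comp Primrec.fst) Primrec.snd))
      (Primrec.nat_mul.comp (h2.comp Primrec.fst)
        (primrec_getD (hq.comp Primrec.fst) Primrec.snd))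
  · exact Primrec.nat_sub.comp (Primrec.nat_add.comp
      (Primrec.nat_mul.comp h1 (Primrec.succ.comp (Primrec.snd.comp hp)))
      (Primrec.nat_mul.comp h2 (Primrec.succ.comp (Primrec.snd.comp hq)))) (Primrec.const 1)

theorem primrec_cutCode {n : α → ℕ} {f : α → RatPointCode → ℕ × ℕ}
    {L : α → List (List RatPointCode)} (hn : Primrec n) (hf : Primrec₂ f) (hL : Primrec L) :
    Primrec fun a => cutCode (n a) (f a) (L a) := by
  have hfl : Primrec fun a => (L a).flatten := Primrec.list_flatten.comp hL
  have hpairs : Primrec fun a => (L a).flatten.flatMap fun p => (L a).flatten.map fun q => (p, q) :=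
    Primrec.list_flatMap hfl (Primrec.list_map (hfl.comp Primrec.fst)
      (Primrec.pair (Primrec.snd.comp Primrec.fst) Primrec.snd).to₂).to₂
  refine Primrec.list_foldl (h := fun a (x : List (List RatPointCode) × _) =>
    if crossCode (f a) x.2.1 x.2.2 = true then
      stellar x.2.1 x.2.2 (midCode (n a) (f a) x.2.1 x.2.2) x.1 else x.1) hpairs hL ?_
  have hx : Primrec fun x : α × (List (List RatPointCode) × (RatPointCode × RatPointCode)) =>
    x.2 := Primrec.snd
  have hp := Primrec.fst.comp (Primrec.snd.comp hx)
  have hq := Primrec.snd.comp (Primrec.snd.comp hx)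
  have hf' : Primrec₂ fun (x : α × (List (List RatPointCode) × (RatPointCode × RatPointCode))) v =>
    f x.1 v := hf.comp (Primrec.fst.comp Primrec.fst) Primrec.snd
  have hfp := hf'.comp Primrec.id hp
  have hfq := hf'.comp Primrec.id hq
  refine Primrec.ite ?_ (primrec_stellar hp hq
    (primrec_midCode (hn.comp Primrec.fst) hf' hp hq) (Primrec.fst.comp hx)) (Primrec.fst.comp hx)
  refine (PrimrecPred.and
    (Primrec.nat_lt.comp (Primrec.fst.comp hfp) (Primrec.snd.comp hfp))
    (Primrec.nat_lt.comp (Primrec.snd.comp hfq) (Primrec.fst.comp hfq))).of_eq fun x => ?_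
  simp [crossCode]

theorem primrec_simplexCode : Primrec simplexCode := by
  refine Primrec.list_cons.comp (Primrec.list_cons.comp (Primrec.const _) ?_) (Primrec.const [])
  refine Primrec.list_map Primrec.list_range (Primrec.pair ?_ (Primrec.const 0))
  refine Primrec.list_map (Primrec.list_range.comp Primrec.fst) ?_
  exact Primrec.ite (Primrec.eq.comp Primrec.snd (Primrec.snd.comp Primrec.fst))
    (Primrec.fst.comp Primrec.fst) (Primrec.const 0)

theorem primrecRel_inCube : PrimrecRel InCube := by
  have h : PrimrecRel fun i (p : RatPointCode) => p.1.getD i 0 ≤ p.2 + 1 :=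
    Primrec.nat_le.comp (primrec_getD Primrec.snd Primrec.fst)
      (Primrec.succ.comp (Primrec.snd.comp Primrec.snd))
  exact ((PrimrecRel.forall_mem_list h).comp (Primrec.list_range.comp Primrec.fst)
    Primrec.snd).of_eq fun x => by simp [InCube]

theorem primrec_cubeCode : Primrec cubeCode := by
  refine Primrec.list_map (Primrec.list_foldl (h := fun n x =>
    cutCode n (fun p => (p.1.getD x.2 0, p.2 + 1)) x.1) Primrec.list_range primrec_simplexCode ?_) ?_
  · refine primrec_cutCode Primrec.fst (Primrec.pair ?_ ?_) (Primrec.fst.comp Primrec.snd)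
    · exact primrec_getD Primrec.snd (Primrec.snd.comp (Primrec.snd.comp Primrec.fst))
    · exact Primrec.succ.comp (Primrec.snd.comp Primrec.snd)
  · exact Primrec₂.swap (PrimrecRel.listFilter primrecRel_inCube.swap)

theorem primrec_refineCode {n : α → ℕ} {t : α → List MVTerm}
    {L : α → List (List RatPointCode)} (hn : Primrec n) (ht : Primrec t) (hL : Primrec L) :
    Primrec fun a => refineCode (n a) (t a) (L a) := by
  refine Primrec.list_foldl (h := fun a (x : _ × (MVTerm × MVTerm)) => cutCode (n a) (fun p =>
      (evalCode p x.2.1 + evalCode p x.2.2, p.2 + 1)) x.1)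
    (Primrec.list_flatMap ht (primrec_sums.comp Primrec.snd).to₂) hL ?_
  refine primrec_cutCode (hn.comp Primrec.fst) (Primrec.pair (Primrec.nat_add.comp ?_ ?_) ?_)
    (Primrec.fst.comp Primrec.snd)
  · exact primrec_evalCode.comp Primrec.snd
      (Primrec.fst.comp (Primrec.snd.comp (Primrec.snd.comp Primrec.fst)))
  · exact primrec_evalCode.comp Primrec.snd
      (Primrec.snd.comp (Primrec.snd.comp (Primrec.snd.comp Primrec.fst)))
  · exact Primrec.succ.comp (Primrec.snd.comp Primrec.snd)

theorem primrec_evalCode_getD {t : α → List MVTerm} {p : α → RatPointCode} {i : α → ℕ}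
    (ht : Primrec t) (hp : Primrec p) (hi : Primrec i) :
    Primrec fun a => evalCode (p a) ((t a).getD (i a) zero) :=
  primrec_evalCode.comp hp ((Primrec.list_getD zero).comp ht hi)

theorem primrec_signedCode : Primrec signedCode := by
  refine Primrec.list_foldl (h := fun t x => cutCode t.length
      (fun p => (evalCode p (t.getD x.2 zero), p.1.getD x.2 0)) x.1)
    (Primrec.list_range.comp Primrec.list_length) (primrec_refineCode Primrec.list_length
      Primrec.id (primrec_cubeCode.comp Primrec.list_length)) ?_
  refine primrec_cutCode (Primrec.list_length.comp Primrec.fst) (Primrec.pair ?_ ?_)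
    (Primrec.fst.comp Primrec.snd)
  · exact primrec_evalCode_getD (Primrec.fst.comp Primrec.fst) Primrec.snd
      (Primrec.snd.comp (Primrec.snd.comp Primrec.fst))
  · exact primrec_getD Primrec.snd (Primrec.snd.comp (Primrec.snd.comp Primrec.fst))

theorem primrecRel_isFixed : PrimrecRel IsFixed := by
  have h : PrimrecRel fun i (x : List MVTerm × RatPointCode) =>
      evalCode x.2 (x.1.getD i zero) = x.2.1.getD i 0 :=
    Primrec.eq.comp (primrec_evalCode_getD (Primrec.fst.comp Primrec.snd)
      (Primrec.snd.comp Primrec.snd) Primrec.fst)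
      (primrec_getD (Primrec.snd.comp Primrec.snd) Primrec.fst)
  exact ((PrimrecRel.forall_mem_list h).comp
    (Primrec.list_range.comp (Primrec.list_length.comp Primrec.fst)) Primrec.id).of_eq fun x => by
      simp [IsFixed]

theorem primrec_fixedCode : Primrec fixedCode :=
  Primrec.list_map primrec_signedCode
    (Primrec₂.swap (PrimrecRel.listFilter primrecRel_isFixed.swap))

theorem primrec_sublists {V : Type*} [Primcodable V] : Primrec (List.sublists (α := V)) := by
  refine (Primrec.list_foldr (h := fun _ (x : V × List (List V)) =>
    x.2.flatMap fun l => [l, x.1 :: l]) Primrec.id (Primrec.const [[]]) ?_).of_eq fun l => rfl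
  refine Primrec.list_flatMap (Primrec.snd.comp Primrec.snd) ?_
  exact Primrec.list_cons.comp Primrec.snd (Primrec.list_cons.comp (Primrec.list_cons.comp
    (Primrec.fst.comp (Primrec.snd.comp Primrec.fst)) Primrec.snd) (Primrec.const []))

theorem primrec_facesCode : Primrec facesCode :=
  Primrec.list_flatMap Primrec.id ((Primrec.listFilter
    (PrimrecPred.not (Primrec.eq.comp Primrec.id (Primrec.const [])))).comp
      (primrec_sublists.comp Primrec.snd))

theorem primrecRel_isPure : PrimrecRel IsPure := by
  have h1 : PrimrecRel fun (m : List RatPointCode) (x : List RatPointCode × ℕ) =>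
      m.length = x.2 + 1 ∧ ∀ v ∈ x.1, v ∈ m :=
    PrimrecPred.and (Primrec.eq.comp (Primrec.list_length.comp Primrec.fst)
      (Primrec.succ.comp (Primrec.snd.comp Primrec.snd)))
      ((PrimrecRel.forall_mem_list primrecRel_mem.swap).comp (Primrec.fst.comp Primrec.snd)
        Primrec.fst)
  have h2 : PrimrecRel fun (l : List RatPointCode) (x : List (List RatPointCode) × ℕ) =>
      ∃ m ∈ x.1, m.length = x.2 + 1 ∧ ∀ v ∈ l, v ∈ m :=
    (PrimrecRel.exists_mem_list h1).comp (Primrec.fst.comp Primrec.snd)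
      (Primrec.pair Primrec.fst (Primrec.snd.comp Primrec.snd))
  exact (PrimrecRel.forall_mem_list h2).comp Primrec.snd (Primrec.pair Primrec.snd Primrec.fst)

theorem primrecPred_idempotentCode : PrimrecPred IdempotentCode := by
  have h1 : PrimrecRel fun (s : MVTerm) (x : RatPointCode × List MVTerm) =>
      evalCode x.1 (subst x.2 s) = evalCode x.1 s :=
    Primrec.eq.comp
      (primrec_evalCode.comp (Primrec.fst.comp Primrec.snd)
        (primrec_subst.comp (Primrec.snd.comp Primrec.snd) Primrec.fst))
      (primrec_evalCode.comp (Primrec.fst.comp Primrec.snd) Primrec.fst)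
  have h2 : PrimrecRel fun (v : RatPointCode) (t : List MVTerm) =>
      ∀ s ∈ t, evalCode v (subst t s) = evalCode v s :=
    (PrimrecRel.forall_mem_list h1).comp Primrec.snd Primrec.id
  refine (PrimrecRel.forall_mem_list h2).comp (Primrec.list_flatten.comp
    (primrec_refineCode Primrec.list_length (Primrec.list_append.comp Primrec.id
      (Primrec.list_map Primrec.id primrec_subst))
      (primrec_cubeCode.comp Primrec.list_length))) Primrec.id

end Primrec

end ConeComplex

/-! ### Homogeneous McNaughton functions -/

namespace MVTerm

/-- The homogeneous version of the McNaughton function of a term. -/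
noncomputable def homEval (n : ℕ) : MVTerm → (Fin n → ℝ) × ℝ → ℝ
  | zero, _ => 0
  | var i, x => if h : i < n then x.1 ⟨i, h⟩ else 0
  | neg s, x => x.2 - homEval n s x
  | oplus s u, x => min x.2 (homEval n s x + homEval n u x)

theorem hat_eq_homEval {n : ℕ} (s : MVTerm) (x : Fin n → I) :
    (s.hat n x : ℝ) = homEval n s (fun i => (x i : ℝ), 1) := by
  induction s with
  | zero => rfl
  | var i =>
    simp only [hat, eval, proj, homEval]
    split_ifs <;> rfl
  | neg s ih =>
    change 1 - (s.hat n x : ℝ) = _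
    rw [ih, homEval]
  | oplus s u ihs ihu =>
    change min 1 ((s.hat n x : ℝ) + (u.hat n x : ℝ)) = _
    rw [ihs, ihu, homEval]

/-- Homogeneity is what allows a rational point to be replaced by any integer vector on its ray. -/
theorem homEval_smul {n : ℕ} (s : MVTerm) (x : (Fin n → ℝ) × ℝ) {a : ℝ} (ha : 0 ≤ a) :
    homEval n s (a • x) = a * homEval n s x := by
  induction s with
  | zero => simp [homEval]
  | var i => simp only [homEval]; split_ifs <;> simp
  | neg s ih => simp [homEval, ih, mul_sub]
  | oplus s u ihs ihu => simp [homEval, ihs, ihu, ← mul_add, mul_min_of_nonneg _ _ ha]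

theorem homEval_subst (t : List MVTerm) (s : MVTerm) (x : (Fin t.length → ℝ) × ℝ) :
    homEval t.length (subst t s) x =
      homEval t.length s (fun i => homEval t.length (t.get i) x, x.2) := by
  induction s with
  | zero => rfl
  | var i =>
    simp only [subst, homEval]
    split_ifs with h
    · simp [h]
    · rw [List.getD_eq_default _ _ (not_lt.1 h)]
      rfl
  | neg s ih => simp [subst, homEval, ih]
  | oplus s u ihs ihu => simp [subst, homEval, ihs, ihu]

theorem VarsBelow.subst {n : ℕ} {t : List MVTerm} (ht : ∀ s ∈ t, s.VarsBelow n) (s : MVTerm) :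
    (subst t s).VarsBelow n := by
  induction s with
  | zero => trivial
  | var i =>
    rw [MVTerm.subst]
    by_cases h : i < t.length
    · rw [List.getD_eq_getElem _ _ h]
      exact ht _ (List.getElem_mem h)
    · rw [List.getD_eq_default _ _ (not_lt.1 h)]
      trivial
  | neg s ih => exact ih
  | oplus s u ihs ihu => exact ⟨ihs, ihu⟩

end MVTerm

/-! ### Correctness of the integer arithmetic and of the subdivisions -/

namespace ConeComplex

open MVTerm

/-- The cone over the unit cube. -/
def cubeCone (n : ℕ) : Set ((Fin n → ℝ) × ℝ) :=
  {x | 0 ≤ x.2 ∧ ∀ i, 0 ≤ x.1 i ∧ x.1 i ≤ x.2}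

/-- Homogeneous coordinates of the point with a given code. -/
noncomputable def homPoint (n : ℕ) (p : RatPointCode) : (Fin n → ℝ) × ℝ :=
  (fun i => (p.1.getD i 0 : ℝ), p.2 + 1)

/-- The upper bound justifies the truncated subtraction for negation in `evalCode`. -/
theorem homEval_mem {n : ℕ} (s : MVTerm) {x : (Fin n → ℝ) × ℝ} (hx : x ∈ cubeCone n) :
    0 ≤ homEval n s x ∧ homEval n s x ≤ x.2 := by
  induction s with
  | zero => exact ⟨le_rfl, hx.1⟩
  | var i =>
    rw [homEval]
    split_ifs
    · exact hx.2 _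
    · exact ⟨le_rfl, hx.1⟩
  | neg s ih => rw [homEval]; constructor <;> linarith
  | oplus s u ihs ihu =>
    exact ⟨le_min hx.1 (add_nonneg ihs.1 ihu.1), min_le_left _ _⟩

theorem evalCode_eq {n : ℕ} {s : MVTerm} (hs : s.VarsBelow n) {p : RatPointCode}
    (hp : homPoint n p ∈ cubeCone n) : (evalCode p s : ℝ) = homEval n s (homPoint n p) := by
  induction s with
  | zero => simp [evalCode, homEval]
  | var i =>
    have hi : i < n := hs
    simp [evalCode, homEval, hi, homPoint]
  | neg s ih =>
    have h1 := ih hs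
    have h2 := (homEval_mem s hp).2
    rw [← h1] at h2
    have h3 : evalCode p s ≤ p.2 + 1 := by
      have : (evalCode p s : ℝ) ≤ p.2 + 1 := h2
      exact_mod_cast this
    rw [evalCode, Nat.cast_sub h3, h1, homEval, homPoint]
    push_cast
    rfl
  | oplus s u ihs ihu =>
    rw [evalCode, homEval, ← ihs hs.1, ← ihu hs.2, homPoint]
    push_cast
    rfl

/-- The sign condition makes both truncated differences genuine. The final `- 1` in the code
compensates for storing the denominator minus one; the positive difference at `q` keeps it harmless.
-/
theorem homPoint_midCode {n : ℕ} {f : RatPointCode → ℕ × ℕ} {p q : RatPointCode}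
    (h : crossCode f p q) : homPoint n (midCode n f p q) =
      (((f q).1 : ℝ) - (f q).2) • homPoint n p + (-(((f p).1 : ℝ) - (f p).2)) • homPoint n q := by
  simp only [crossCode, Bool.and_eq_true, decide_eq_true_eq] at h
  have h1 : (((f q).1 - (f q).2 : ℕ) : ℝ) = (f q).1 - (f q).2 := Nat.cast_sub h.2.le
  have h2 : (((f p).2 - (f p).1 : ℕ) : ℝ) = (f p).2 - (f p).1 := Nat.cast_sub h.1.le
  ext i
  · simp only [homPoint, midCode, Prod.fst_add, Prod.smul_fst, Pi.add_apply, Pi.smul_apply,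
      smul_eq_mul]
    rw [List.getD_eq_getElem _ _ (by simp)]
    simp only [List.getElem_map, List.getElem_range]
    push_cast
    rw [h1, h2]
    ring
  · have h3 : 1 ≤ ((f q).1 - (f q).2) * (p.2 + 1) + ((f p).2 - (f p).1) * (q.2 + 1) := by
      have : 1 ≤ (f q).1 - (f q).2 := by omega
      nlinarith [Nat.zero_le (((f p).2 - (f p).1) * (q.2 + 1)), Nat.zero_le p.2]
    simp only [homPoint, midCode, Prod.snd_add, Prod.smul_snd, smul_eq_mul]
    rw [Nat.cast_sub h3]
    push_cast
    rw [h1, h2]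
    ring

/-- The integer data need to agree with `F` only on the cone, since all vertices of cells lie there.
-/
theorem cutCode_spec {n : ℕ} {f : RatPointCode → ℕ × ℕ} {F : (Fin n → ℝ) × ℝ → ℝ}
    {L : List (List RatPointCode)}
    (hf : ∀ v, homPoint n v ∈ cone (homPoint n) L → F (homPoint n v) = (f v).1 - (f v).2)
    (hL : Embedded (homPoint n) L) (hn : ∀ l ∈ L, l.Nodup) (hF : LinearOn (homPoint n) L F) :
    Refines (homPoint n) L (cutCode n f L) ∧ SignedOn (homPoint n) (cutCode n f L) F := by
  have hf' : ∀ v ∈ L.flatten, F (homPoint n v) = (f v).1 - (f v).2 := fun v hv => by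
    obtain ⟨l, hl, hv⟩ := List.mem_flatten.1 hv
    exact hf v (pos_mem_cone hl hv)
  refine cut_spec (fun p hp q hq => ?_) (fun p hp q hq h => ?_) hL hn hF
  · rw [hf' p hp, hf' q hq, sub_neg, sub_pos, Nat.cast_lt, Nat.cast_lt]
    simp [crossCode]
  · rw [hf' p hp, hf' q hq, homPoint_midCode h]

/-- Later cuts keep the constant signs obtained by earlier ones, because `Refines` preserves them
for every function linear on the cells. -/
theorem foldl_cutCode_spec {ι : Type*} {n : ℕ} {f : ι → RatPointCode → ℕ × ℕ}
    {F : ι → (Fin n → ℝ) × ℝ → ℝ} (P : List ι) {L : List (List RatPointCode)}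
    (hf : ∀ i ∈ P, ∀ v, homPoint n v ∈ cone (homPoint n) L →
      F i (homPoint n v) = (f i v).1 - (f i v).2)
    (hL : Embedded (homPoint n) L) (hn : ∀ l ∈ L, l.Nodup)
    (hF : ∀ i ∈ P, LinearOn (homPoint n) L (F i)) :
    Refines (homPoint n) L (P.foldl (fun L i => cutCode n (f i) L) L) ∧
      ∀ i ∈ P, SignedOn (homPoint n) (P.foldl (fun L i => cutCode n (f i) L) L) (F i) := by
  induction P generalizing L with
  | nil => exact ⟨Refines.refl hL hn, by simp⟩
  | cons i P ih =>
    obtain ⟨h1, h2⟩ := cutCode_spec (hf i List.mem_cons_self) hL hn (hF i List.mem_cons_self)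
    obtain ⟨h3, h4⟩ := ih (L := cutCode n (f i) L)
      (fun j hj v hv => hf j (List.mem_cons_of_mem _ hj) v (h1.cone_eq ▸ hv)) h1.embedded h1.nodup
      fun j hj => h1.linearOn _ (hF j (List.mem_cons_of_mem _ hj))
    refine ⟨h1.trans h3, fun j hj => ?_⟩
    rcases List.mem_cons.1 hj with rfl | hj
    · exact h3.signedOn _ (h1.linearOn _ (hF _ List.mem_cons_self)) h2
    · exact h4 j hj

/-- The only nonlinearity is the truncation in ⊕. Once both summands are linear on the cells,
cutting where their sum equals the denominator makes the minimum linear; hence inner sums must come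
first. -/
theorem foldl_sums_spec {n : ℕ} (s : MVTerm) (hs : s.VarsBelow n) {L : List (List RatPointCode)}
    (hL : Embedded (homPoint n) L) (hn : ∀ l ∈ L, l.Nodup)
    (hc : cone (homPoint n) L = cubeCone n) :
    Refines (homPoint n) L (s.sums.foldl (fun L su =>
      cutCode n (fun p => (evalCode p su.1 + evalCode p su.2, p.2 + 1)) L) L) ∧
    LinearOn (homPoint n) (s.sums.foldl (fun L su =>
      cutCode n (fun p => (evalCode p su.1 + evalCode p su.2, p.2 + 1)) L) L) (homEval n s) := by
  induction s generalizing L with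
  | zero =>
    exact ⟨Refines.refl hL hn, linearOn_linearMap (0 : ((Fin n → ℝ) × ℝ) →ₗ[ℝ] ℝ)⟩
  | var i =>
    refine ⟨Refines.refl hL hn, ?_⟩
    have hi : i < n := hs
    convert! linearOn_linearMap (LinearMap.proj (R := ℝ) (φ := fun _ : Fin n => ℝ) ⟨i, hi⟩ ∘ₗ
      LinearMap.fst ℝ (Fin n → ℝ) ℝ) using 1
    ext x
    simp [homEval, hi]
  | neg s ih =>
    obtain ⟨h1, h2⟩ := ih hs hL hn hc
    exact ⟨h1, (linearOn_linearMap (LinearMap.snd ℝ (Fin n → ℝ) ℝ)).sub h2⟩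
  | oplus s u ihs ihu =>
    obtain ⟨h1, h2⟩ := ihs hs.1 hL hn hc
    obtain ⟨h3, h4⟩ := ihu hs.2 h1.embedded h1.nodup (h1.cone_eq.trans hc)
    have h5 := h3.linearOn _ h2
    have hD := linearOn_linearMap (pos := homPoint n) (LinearMap.snd ℝ (Fin n → ℝ) ℝ)
      (L := u.sums.foldl (fun L su =>
        cutCode n (fun p => (evalCode p su.1 + evalCode p su.2, p.2 + 1)) L)
        (s.sums.foldl (fun L su =>
        cutCode n (fun p => (evalCode p su.1 + evalCode p su.2, p.2 + 1)) L) L))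
    obtain ⟨h6, h7⟩ := cutCode_spec (F := fun x => (homEval n s x + homEval n u x) - x.2)
      (f := fun p => (evalCode p s + evalCode p u, p.2 + 1))
      (fun v hv => by
        rw [h3.cone_eq, h1.cone_eq, hc] at hv
        push_cast
        rw [evalCode_eq hs.1 hv, evalCode_eq hs.2 hv, homPoint])
      h3.embedded h3.nodup ((h5.add h4).sub hD)
    rw [sums, List.foldl_append, List.foldl_append, List.foldl_cons, List.foldl_nil]
    exact ⟨(h1.trans h3).trans h6,
      (h6.linearOn _ hD).min ((h6.linearOn _ h5).add (h6.linearOn _ h4)) h7⟩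

theorem refineCode_spec {n : ℕ} (ts : List MVTerm) (hts : ∀ s ∈ ts, s.VarsBelow n)
    {L : List (List RatPointCode)} (hL : Embedded (homPoint n) L) (hn : ∀ l ∈ L, l.Nodup)
    (hc : cone (homPoint n) L = cubeCone n) :
    Refines (homPoint n) L (refineCode n ts L) ∧
      ∀ s ∈ ts, LinearOn (homPoint n) (refineCode n ts L) (homEval n s) := by
  induction ts generalizing L with
  | nil => exact ⟨Refines.refl hL hn, by simp⟩
  | cons s ts ih =>
    obtain ⟨h1, h2⟩ := foldl_sums_spec s (hts s List.mem_cons_self) hL hn hc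
    obtain ⟨h3, h4⟩ := ih (fun u hu => hts u (List.mem_cons_of_mem _ hu)) h1.embedded h1.nodup
      (h1.cone_eq.trans hc)
    rw [refineCode, List.flatMap_cons, List.foldl_append]
    refine ⟨h1.trans h3, fun u hu => ?_⟩
    rcases List.mem_cons.1 hu with rfl | hu
    · exact h3.linearOn _ h2
    · exact h4 u hu

/-! #### The triangulation of the cube -/

theorem getD_simplexVertex {n : ℕ} {i j : ℕ} (hj : j < n) :
    (((List.range n).map fun k => if k = i then n else 0, 0) : RatPointCode).1.getD j 0 =
      if j = i then n else 0 := by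
  rw [List.getD_eq_getElem _ _ (by simpa using hj)]
  simp

/-- The vertices are 0 and n·e_i, linearly independent in homogeneous coordinates. The simplex {x ≥
0, ∑ x_i ≤ n} contains the cube. -/
theorem simplexCode_spec (n : ℕ) : Embedded (homPoint n) (simplexCode n) ∧
    (∀ l ∈ simplexCode n, l.Nodup) ∧ cubeCone n ⊆ cone (homPoint n) (simplexCode n) := by
  set e : ℕ → RatPointCode := fun i => ((List.range n).map fun k => if k = i then n else 0, 0)
    with he
  have hcoord : ∀ i j : ℕ, j < n → (e i).1.getD j 0 = if j = i then n else 0 :=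
    fun i j hj => getD_simplexVertex hj
  have hS : simplexCode n = [([], 0) :: (List.range n).map e] := rfl
  have hmem : ∀ v, v ∈ (([], 0) : RatPointCode) :: (List.range n).map e →
      v = ([], 0) ∨ ∃ i < n, v = e i := by
    intro v hv
    rcases List.mem_cons.1 hv with h | h
    · exact Or.inl h
    · obtain ⟨i, hi, rfl⟩ := List.mem_map.1 h
      exact Or.inr ⟨i, List.mem_range.1 hi, rfl⟩
  have hbary : ∀ w ∈ Weights ((([], 0) : RatPointCode) :: (List.range n).map e), ∀ i : Fin n,
      (bary (homPoint n) w).1 i = w (e i) * n := by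
    intro w hw i
    rw [bary, Finsupp.linearCombination_apply, Finsupp.sum, Prod.fst_sum, Finset.sum_apply,
      Finset.sum_eq_single (e i)]
    · simp only [homPoint, Prod.smul_fst, Pi.smul_apply, smul_eq_mul, hcoord i i i.2, if_true]
    · intro v hv hne
      rcases hmem v (hw.2 v (by simpa using hv)) with rfl | ⟨j, hj, rfl⟩
      · simp [homPoint]
      · have : (i : ℕ) ≠ j := fun h => hne (by rw [h])
        simp only [homPoint, Prod.smul_fst, Pi.smul_apply, smul_eq_mul, hcoord j i i.2, if_neg this,
          Nat.cast_zero, mul_zero]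
    · intro h
      simp [Finsupp.notMem_support_iff.1 h]
  rw [hS]
  refine ⟨?_, ?_, ?_⟩
  · intro l hl m hm w hw w' hw' h
    rw [List.mem_singleton] at hl hm
    subst hl hm
    have h1 : ∀ i < n, w (e i) = w' (e i) := by
      intro i hi
      have := congrFun (congrArg Prod.fst h) ⟨i, hi⟩
      rw [hbary w hw, hbary w' hw'] at this
      exact mul_right_cancel₀ (by exact_mod_cast (Nat.zero_lt_of_lt hi).ne') this
    -- The coordinates determine all weights except that of the origin, which the homogenizing
    -- coordinate then settles.
    have h2 : w - w' = Finsupp.single (([], 0) : RatPointCode) (w ([], 0) - w' ([], 0)) := by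
      ext v
      by_cases hv : v ∈ (([], 0) : RatPointCode) :: (List.range n).map e
      · by_cases hv0 : v = ([], 0)
        · subst hv0; simp
        · obtain ⟨i, hi, rfl⟩ := (hmem v hv).resolve_left hv0
          simp [h1 i hi, Ne.symm hv0]
      · have h3 : w v = 0 := by_contra fun h => hv (hw.2 v h)
        have h4 : w' v = 0 := by_contra fun h => hv (hw'.2 v h)
        have h5 : (([], 0) : RatPointCode) ≠ v := fun h => hv (h ▸ List.mem_cons_self)
        simp [h3, h4, h5]
    have h3 : bary (homPoint n) (w - w') = 0 := by rw [bary, map_sub]; exact sub_eq_zero.2 h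
    rw [h2] at h3
    have h4 := congrArg Prod.snd h3
    simp only [bary, Finsupp.linearCombination_single, homPoint, Prod.smul_snd, Nat.cast_zero,
      zero_add, smul_eq_mul, mul_one, Prod.snd_zero] at h4
    rw [h4, Finsupp.single_zero, sub_eq_zero] at h2
    exact h2
  · intro l hl
    rw [List.mem_singleton] at hl
    subst hl
    refine List.nodup_cons.2 ⟨fun h => ?_, List.Nodup.map_on (fun i hi j hj hij => ?_)
      List.nodup_range⟩
    · obtain ⟨i, hi, h⟩ := List.mem_map.1 h
      have := congrArg (fun v : RatPointCode => v.1.length) h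
      simp only [he, List.length_map, List.length_range, List.length_nil] at this
      simp [this] at hi
    · rw [List.mem_range] at hi hj
      by_contra hne
      have h1 := hcoord i i hi
      rw [hij, hcoord j i hi, if_neg hne, if_pos rfl] at h1
      omega
  · intro x hx
    -- Weight x_i / n at n·e_i produces the coordinates; the rest of the homogenizing coordinate
    -- goes to the origin, which does not change them.
    refine ⟨_, List.mem_singleton_self _, Finsupp.single ([], 0) (x.2 - ∑ i : Fin n, x.1 i / n) +
      ∑ i : Fin n, Finsupp.single (e i) (x.1 i / n), ?_, ?_⟩
    · refine add_mem_weights (single_mem_weights List.mem_cons_self ?_) ?_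
      · rcases Nat.eq_zero_or_pos n with rfl | hn
        · simpa using hx.1
        have : ∑ i : Fin n, x.1 i / n ≤ ∑ i : Fin n, x.2 / n := by
          gcongr with i
          exact (hx.2 i).2
        have hn' : (n : ℝ) ≠ 0 := by exact_mod_cast hn.ne'
        simp only [Finset.sum_const, Finset.card_univ, Fintype.card_fin, nsmul_eq_mul] at this
        rw [mul_div_cancel₀ _ hn'] at this
        linarith
      · refine Finset.sum_induction _ (· ∈ Weights _) (fun _ _ => add_mem_weights)
          ⟨by simp, by simp⟩ fun i _ => single_mem_weights ?_ (div_nonneg (hx.2 i).1 (by simp))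
        exact List.mem_cons_of_mem _ (List.mem_map_of_mem (List.mem_range.2 i.2))
    · simp only [bary, map_add, map_sum, Finsupp.linearCombination_single]
      ext j
      · simp only [homPoint, Prod.fst_add, Prod.smul_fst, Prod.fst_sum, Pi.add_apply,
          Pi.smul_apply, Finset.sum_apply, smul_eq_mul]
        rw [Finset.sum_eq_single (f := fun i : Fin n => x.1 i / n * ((e i).1.getD j 0 : ℝ)) j]
        · have hn : (n : ℝ) ≠ 0 := by exact_mod_cast (Nat.zero_lt_of_lt j.2).ne'
          rw [hcoord j j j.2, if_pos rfl]
          simp [div_mul_cancel₀ _ hn]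
        · intro i _ hne
          have : (j : ℕ) ≠ i := fun h => hne (Fin.ext h.symm)
          rw [hcoord i j j.2, if_neg this]
          simp
        · simp
      · simp [homPoint, he, Prod.snd_sum]

/-- Only the inequalities x_i ≤ 1 require cuts; nonnegativity is built into the simplex and its
codes. -/
theorem cubeCode_spec (n : ℕ) : Embedded (homPoint n) (cubeCode n) ∧
    (∀ l ∈ cubeCode n, l.Nodup) ∧ cone (homPoint n) (cubeCode n) = cubeCone n := by
  obtain ⟨h1, h2, h3⟩ := simplexCode_spec n
  let F : ℕ → (Fin n → ℝ) × ℝ → ℝ := fun i x => homEval n (var i) x - x.2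
  have hlin : ∀ (i : Fin n) L, LinearOn (homPoint n) L (F i) := by
    intro i L
    convert! linearOn_linearMap (LinearMap.proj (R := ℝ) (φ := fun _ : Fin n => ℝ) i ∘ₗ
      LinearMap.fst ℝ (Fin n → ℝ) ℝ - LinearMap.snd ℝ (Fin n → ℝ) ℝ) using 1
    ext x
    simp [F, homEval]
  have hval : ∀ i < n, ∀ v, F i (homPoint n v) = (v.1.getD i 0 : ℝ) - ((v.2 + 1 : ℕ) : ℝ) := by
    intro i hi v
    simp [F, homEval, homPoint, hi]
  obtain ⟨h4, h5⟩ := foldl_cutCode_spec (F := F) (f := fun i p => (p.1.getD i 0, p.2 + 1))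
    (List.range n) (fun i hi v _ => hval i (List.mem_range.1 hi) v) h1 h2
    (fun i hi => hlin ⟨i, List.mem_range.1 hi⟩ _)
  refine ⟨h4.embedded.restrict _, nodup_restrict _ h4.nodup, ?_⟩
  rw [cubeCode, cone_restrict (F := fun i : Fin n => F i) _ (fun i => hlin i _)
    (fun i => h5 i (List.mem_range.2 i.2)), h4.cone_eq]
  · ext x
    constructor
    · rintro ⟨⟨l, hl, w, hw, rfl⟩, hx⟩
      refine ⟨?_, fun i => ⟨?_, ?_⟩⟩
      · have := linearOn_linearMap (pos := homPoint n) (LinearMap.snd ℝ (Fin n → ℝ) ℝ) l hl w hw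
        rw [LinearMap.snd_apply] at this
        rw [this]
        exact bary_nonneg hw fun v _ => by simp only [homPoint, LinearMap.snd_apply]; positivity
      · have := linearOn_linearMap (pos := homPoint n) (LinearMap.proj (R := ℝ)
          (φ := fun _ : Fin n => ℝ) i ∘ₗ LinearMap.fst ℝ (Fin n → ℝ) ℝ) l hl w hw
        simp only [LinearMap.comp_apply, LinearMap.fst_apply, LinearMap.proj_apply] at this
        rw [this]
        exact bary_nonneg hw fun v _ => by simp [homPoint]
      · have := hx i
        simp only [F, homEval, i.2, dif_pos, sub_nonpos] at this
        exact this
    · intro hx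
      refine ⟨h3 hx, fun i => ?_⟩
      simp only [F, homEval, i.2, dif_pos, sub_nonpos]
      exact (hx.2 i).2
  · intro v _
    rw [decide_eq_true_iff]
    constructor
    · intro h i
      rw [hval i i.2, sub_nonpos]
      exact_mod_cast h i i.2
    · intro h i hi
      have := h ⟨i, hi⟩
      rw [hval i hi, sub_nonpos] at this
      exact_mod_cast this

/-! #### Decision of idempotence -/

theorem mem_cubeCone_of_mem {n : ℕ} (x : Fin n → I) : (fun i => (x i : ℝ), 1) ∈ cubeCone n :=
  ⟨zero_le_one, fun i => (x i).2⟩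

theorem hatMap_apply (t : List MVTerm) (x : Fin t.length → I) (i : Fin t.length) :
    (hatMap t x i : ℝ) = homEval t.length (t.get i) (fun i => (x i : ℝ), 1) :=
  hat_eq_homEval _ _

theorem hatMap_hatMap_apply (t : List MVTerm) (x : Fin t.length → I) (i : Fin t.length) :
    (hatMap t (hatMap t x) i : ℝ) =
      homEval t.length (subst t (t.get i)) (fun i => (x i : ℝ), 1) := by
  rw [hatMap_apply, homEval_subst]
  simp only [hatMap_apply]

/-- After the refinement, each term and its substitution instance are linear on every cell, so they
agree on the cube as soon as they agree at the vertices. -/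
theorem idempotentCode_iff {t : List MVTerm} (ht : ∀ s ∈ t, s.VarsBelow t.length) :
    IdempotentCode t ↔ hatMap t ∘ hatMap t = hatMap t := by
  obtain ⟨h1, h2, h3⟩ := cubeCode_spec t.length
  have hts : ∀ s ∈ t ++ t.map (subst t), s.VarsBelow t.length := by
    intro s hs
    rcases List.mem_append.1 hs with h | h
    · exact ht s h
    · obtain ⟨u, -, rfl⟩ := List.mem_map.1 h
      exact VarsBelow.subst ht u
  obtain ⟨h4, h5⟩ := refineCode_spec _ hts h1 h2 h3
  have h6 := h4.cone_eq.trans h3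
  have hval : ∀ s ∈ t, ∀ v, homPoint t.length v ∈ cubeCone t.length →
      (evalCode v (subst t s) = evalCode v s ↔
        homEval t.length (subst t s) (homPoint t.length v) =
          homEval t.length s (homPoint t.length v)) := by
    intro s hs v hv
    rw [← evalCode_eq (ht s hs) hv, ← evalCode_eq (VarsBelow.subst ht s) hv, Nat.cast_inj]
  constructor
  · intro h
    funext x i
    apply Subtype.ext
    rw [Function.comp_apply, hatMap_hatMap_apply, hatMap_apply]
    have hx := mem_cubeCone_of_mem x
    rw [← h6] at hx
    obtain ⟨l, hl, w, hw, hx⟩ := hx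
    have hi : t.get i ∈ t := List.get_mem t i
    rw [← hx, h5 _ (List.mem_append_left _ hi) l hl w hw,
      h5 _ (List.mem_append_right _ (List.mem_map_of_mem hi)) l hl w hw]
    refine bary_congr hw fun v hv => ?_
    exact (hval _ hi v (h6 ▸ pos_mem_cone hl hv)).1 (h v (List.mem_flatten.2 ⟨l, hl, hv⟩) _ hi)
  · intro h v hv s hs
    obtain ⟨l, hl, hv⟩ := List.mem_flatten.1 hv
    have hvc : homPoint t.length v ∈ cubeCone t.length := h6 ▸ pos_mem_cone hl hv
    rw [hval s hs v hvc]
    obtain ⟨i, rfl⟩ := List.get_of_mem hs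
    have hD : (0 : ℝ) < v.2 + 1 := by positivity
    -- Each vertex vector is a positive multiple of a point of the cube, so homogeneity transfers
    -- the identity to it.
    let x : Fin t.length → I := fun i => ⟨(v.1.getD i 0 : ℝ) / (v.2 + 1),
      div_nonneg (hvc.2 i).1 hD.le, (div_le_one hD).2 (hvc.2 i).2⟩
    have hx : homPoint t.length v = ((v.2 + 1 : ℝ)) • ((fun i => (x i : ℝ)), (1 : ℝ)) := by
      ext j
      · simp [homPoint, x, mul_div_cancel₀ _ hD.ne']
      · simp [homPoint]
    rw [hx, homEval_smul _ _ hD.le, homEval_smul _ _ hD.le, ← hatMap_hatMap_apply, ← hatMap_apply]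
    have := congrFun h x
    rw [Function.comp_apply] at this
    rw [this]

theorem computablePred_isInstance : ComputablePred IsInstance := by
  have h1 : PrimrecPred fun t : List MVTerm => ∀ s ∈ t, s.VarsBelow t.length :=
    (PrimrecRel.forall_mem_list primrec_varsBelow.swap).comp Primrec.id Primrec.list_length
  have h2 : PrimrecPred fun t : List MVTerm =>
      t ≠ [] ∧ (∀ s ∈ t, s.VarsBelow t.length) ∧ IdempotentCode t :=
    PrimrecPred.and (PrimrecPred.not (Primrec.eq.comp Primrec.id (Primrec.const [])))
      (PrimrecPred.and h1 primrecPred_idempotentCode)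
  obtain ⟨_, h3⟩ := h2.of_eq (q := IsInstance) fun t => by
    rw [IsInstance]
    exact and_congr_right fun _ => and_congr_right fun h => idempotentCode_iff h
  exact ⟨inferInstance, h3.to_comp⟩

/-! #### The triangulation of the set of fixed points -/

/-- Since t_i - X_i is linear of constant sign on each cell, its zero set there is the face spanned
by the vertices at which it vanishes. -/
theorem fixedCode_spec {t : List MVTerm} (ht : ∀ s ∈ t, s.VarsBelow t.length) :
    Embedded (homPoint t.length) (fixedCode t) ∧ (∀ l ∈ fixedCode t, l.Nodup) ∧
      cone (homPoint t.length) (fixedCode t) =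
        {x ∈ cubeCone t.length | ∀ i, homEval t.length (t.get i) x = x.1 i} := by
  obtain ⟨h1, h2, h3⟩ := cubeCode_spec t.length
  obtain ⟨h4, h5⟩ := refineCode_spec _ ht h1 h2 h3
  have h6 := h4.cone_eq.trans h3
  let F : ℕ → (Fin t.length → ℝ) × ℝ → ℝ := fun i x =>
    homEval t.length (t.getD i zero) x - homEval t.length (var i) x
  have hF : ∀ (i : Fin t.length) x, F i x = homEval t.length (t.get i) x - x.1 i := by
    intro i x
    simp [F, homEval]
  have hlin : ∀ i : Fin t.length,
      LinearOn (homPoint t.length) (refineCode t.length t (cubeCode t.length)) (F i) := by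
    intro i
    have := (h5 _ (List.get_mem t i)).sub (linearOn_linearMap (pos := homPoint t.length)
      (LinearMap.proj (R := ℝ) (φ := fun _ : Fin t.length => ℝ) i ∘ₗ
        LinearMap.fst ℝ (Fin t.length → ℝ) ℝ))
    convert! this using 1
    ext x
    simp [hF]
  have hval : ∀ i < t.length, ∀ v, homPoint t.length v ∈ cubeCone t.length →
      F i (homPoint t.length v) = (evalCode v (t.getD i zero) : ℝ) - (v.1.getD i 0 : ℝ) := by
    intro i hi v hv
    rw [hF ⟨i, hi⟩, evalCode_eq _ hv]
    · simp [homPoint, hi]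
    · rw [List.getD_eq_getElem _ _ hi]
      exact ht _ (List.getElem_mem hi)
  obtain ⟨h7, h8⟩ := foldl_cutCode_spec (F := F)
    (f := fun i p => (evalCode p (t.getD i zero), p.1.getD i 0))
    (List.range t.length) (fun i hi v hv => hval i (List.mem_range.1 hi) v (h6 ▸ hv))
    h4.embedded h4.nodup (fun i hi => hlin ⟨i, List.mem_range.1 hi⟩)
  have h9 := h7.cone_eq.trans h6
  refine ⟨h7.embedded.restrict _, nodup_restrict _ h7.nodup, ?_⟩
  -- Each equation is imposed as a pair of opposite inequalities, indexed by the two summands.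
  rw [fixedCode, signedCode, cone_restrict
    (F := fun (i : Fin t.length ⊕ Fin t.length) x =>
      i.elim (fun i : Fin t.length => F i x) fun i : Fin t.length => - F i x), h9]
  · ext x
    refine and_congr_right fun _ => ?_
    simp only [Sum.forall, Sum.elim_inl, Sum.elim_inr, hF]
    exact ⟨fun h i => by linarith [h.1 i, h.2 i], fun h =>
      ⟨fun i => by linarith [h i], fun i => by linarith [h i]⟩⟩
  · rintro (i | i)
    · exact h7.linearOn _ (hlin i)
    · exact (h7.linearOn _ (hlin i)).neg
  · rintro (i | i)
    · exact h8 i (List.mem_range.2 i.2)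
    · exact (h8 i (List.mem_range.2 i.2)).neg
  · intro v hv
    obtain ⟨l, hl, hv⟩ := List.mem_flatten.1 hv
    have hvc : homPoint t.length v ∈ cubeCone t.length := h9 ▸ pos_mem_cone hl hv
    rw [decide_eq_true_iff]
    simp only [Sum.forall, Sum.elim_inl, Sum.elim_inr]
    constructor
    · intro h
      refine ⟨fun i => ?_, fun i => ?_⟩ <;> rw [hval i i.2 v hvc, h i i.2] <;> simp
    · intro h i hi
      have := h.1 ⟨i, hi⟩
      have := h.2 ⟨i, hi⟩
      have := hval i hi v hvc
      have h : (evalCode v (t.getD i zero) : ℝ) = v.1.getD i 0 := by linarith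
      exact_mod_cast h

end ConeComplex

/-! ### From lists of cells to geometric simplicial complexes -/

namespace ConeComplex

open MVTerm

theorem homPoint_eq (n : ℕ) (p : RatPointCode) :
    homPoint n p = (p.2 + 1 : ℝ) • (p.toPoint n, (1 : ℝ)) := by
  have hD : (p.2 + 1 : ℝ) ≠ 0 := by positivity
  ext i
  · simp [homPoint, RatPointCode.toPoint, mul_div_cancel₀ _ hD]
  · simp [homPoint]

theorem bary_single_homPoint (n : ℕ) (p : RatPointCode) (a : ℝ) :
    bary (homPoint n) (Finsupp.single p (a / (p.2 + 1))) = a • (p.toPoint n, (1 : ℝ)) := by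
  have hD : (p.2 + 1 : ℝ) ≠ 0 := by positivity
  rw [bary, Finsupp.linearCombination_single, homPoint_eq, smul_smul, div_mul_cancel₀ _ hD]

/-- The vertices of a cell. -/
noncomputable def vertexFinset (n : ℕ) (l : List RatPointCode) : Finset (Fin n → ℝ) :=
  l.toFinset.image (RatPointCode.toPoint n)

theorem coe_vertexFinset (n : ℕ) (l : List RatPointCode) :
    (vertexFinset n l : Set (Fin n → ℝ)) = {x | ∃ p ∈ l, p.toPoint n = x} := by
  ext x
  simp [vertexFinset]

theorem mem_vertexFinset {n : ℕ} {l : List RatPointCode} {x : Fin n → ℝ} :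
    x ∈ vertexFinset n l ↔ ∃ p ∈ l, p.toPoint n = x := by
  simp [vertexFinset]

theorem mem_vertexSets_iff {n : ℕ} {T : List (List RatPointCode)} {s : Finset (Fin n → ℝ)} :
    s ∈ vertexSets n T ↔ ∃ l ∈ T, s = vertexFinset n l := by
  refine exists_congr fun l => and_congr_right fun _ => ?_
  rw [← coe_vertexFinset, Finset.coe_inj]

theorem mem_facesCode {L : List (List RatPointCode)} {l : List RatPointCode} :
    l ∈ facesCode L ↔ l ≠ [] ∧ ∃ m ∈ L, l.Sublist m := by
  simp only [facesCode, List.mem_flatMap, List.mem_filter, List.mem_sublists, decide_eq_true_iff]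
  exact ⟨fun ⟨m, h1, h2, h3⟩ => ⟨h3, m, h1, h2⟩, fun ⟨h3, m, h1, h2⟩ => ⟨m, h1, h2, h3⟩⟩

/-- The simplex is the slice of its cone at height 1: the last coordinate says that the weights,
rescaled by the denominators, sum to 1. -/
theorem mem_convexHull_vertexFinset {n : ℕ} {l : List RatPointCode} {x : Fin n → ℝ} :
    x ∈ convexHull ℝ (vertexFinset n l : Set (Fin n → ℝ)) ↔
      ∃ w ∈ Weights l, bary (homPoint n) w = (x, 1) := by
  constructor
  · intro hx
    have hconv : Convex ℝ {x : Fin n → ℝ | ∃ w ∈ Weights l, bary (homPoint n) w = (x, 1)} := by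
      rintro x ⟨w, hw, hx⟩ y ⟨w', hw', hy⟩ a b ha hb hab
      refine ⟨a • w + b • w', add_mem_weights (smul_mem_weights hw ha) (smul_mem_weights hw' hb), ?_⟩
      rw [bary, map_add, map_smul, map_smul]
      simp only [bary] at hx hy
      rw [hx, hy]
      ext i
      · simp
      · simpa using hab
    refine convexHull_min ?_ hconv hx
    intro y hy
    rw [Finset.mem_coe, mem_vertexFinset] at hy
    obtain ⟨p, hp, rfl⟩ := hy
    exact ⟨_, single_mem_weights hp (a := 1 / (p.2 + 1)) (by positivity), by
      rw [bary_single_homPoint, one_smul]⟩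
  · rintro ⟨w, hw, hx⟩
    rw [bary, Finsupp.linearCombination_apply, Finsupp.sum] at hx
    have h1 := congrArg Prod.fst hx
    have h2 := congrArg Prod.snd hx
    simp only [homPoint_eq, smul_smul, Prod.fst_sum, Prod.snd_sum, Prod.smul_fst, Prod.smul_snd,
      smul_eq_mul, mul_one] at h1 h2
    rw [← h1]
    refine (convex_convexHull ℝ _).sum_mem (fun v _ => mul_nonneg (hw.1 v) (by positivity)) h2
      fun v hv => subset_convexHull ℝ _ ?_
    rw [Finset.mem_coe, mem_vertexFinset]
    exact ⟨v, hw.2 v (by simpa using hv), rfl⟩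

section Embedded

variable {n : ℕ} {L : List (List RatPointCode)} (hL : Embedded (homPoint n) L)
include hL

/-- Codes are not reduced fractions, so a point has many codes. Two codes of one point span the same
ray, and embeddedness allows only one of them as a vertex. -/
theorem Embedded.eq_of_toPoint_eq {l m : List RatPointCode} (hl : l ∈ L) (hm : m ∈ L)
    {p q : RatPointCode} (hp : p ∈ l) (hq : q ∈ m) (h : p.toPoint n = q.toPoint n) : p = q := by
  have h1 := hL l hl m hm _ (single_mem_weights hp (a := 1 / (p.2 + 1)) (by positivity)) _
    (single_mem_weights hq (a := 1 / (q.2 + 1)) (by positivity)) (by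
      rw [bary_single_homPoint, bary_single_homPoint, h])
  have hD : (1 / (p.2 + 1) : ℝ) ≠ 0 := by positivity
  rcases (Finsupp.single_eq_single_iff _ _ _ _).1 h1 with h | h
  · exact h.1
  · exact absurd h.1 hD

/-- Splitting an affine relation into positive and negative parts gives two nonnegative weights for
one point of the cone; they coincide, so the relation is trivial. -/
theorem Embedded.affineIndependent {l : List RatPointCode} (hl : l ∈ L) :
    AffineIndependent ℝ fun v : {v // v ∈ l} => v.1.toPoint n := by
  rw [affineIndependent_iff]
  intro s w hw hsum
  let W : ({v // v ∈ l} → ℝ) → RatPointCode →₀ ℝ := fun a =>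
    ∑ e ∈ s, Finsupp.single e.1 (a e / (e.1.2 + 1))
  have hW : ∀ a, (∀ e, 0 ≤ a e) → W a ∈ Weights l := fun a ha =>
    Finset.sum_induction _ (· ∈ Weights l) (fun _ _ => add_mem_weights) ⟨by simp, by simp⟩
      fun e _ => single_mem_weights e.2 (div_nonneg (ha e) (by positivity))
  have hb : ∀ a, bary (homPoint n) (W a) = ∑ e ∈ s, a e • (e.1.toPoint n, (1 : ℝ)) := by
    intro a
    simp only [W, bary, map_sum]
    exact Finset.sum_congr rfl fun e _ => bary_single_homPoint n e.1 (a e)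
  have key := hL l hl l hl _ (hW (fun e => max (w e) 0) fun e => le_max_right _ _) _
    (hW (fun e => max (-w e) 0) fun e => le_max_right _ _) (by
      rw [hb, hb, ← sub_eq_zero, ← Finset.sum_sub_distrib]
      have : ∀ e, max (w e) 0 • (e.1.toPoint n, (1 : ℝ)) - max (-w e) 0 • (e.1.toPoint n, (1 : ℝ)) =
          (w e • e.1.toPoint n, w e) := by
        intro e
        rw [← sub_smul, max_zero_sub_max_neg_zero_eq_self]
        ext i <;> simp
      simp only [this]
      ext i
      · simpa [Prod.fst_sum] using congrFun hsum i
      · simpa [Prod.snd_sum] using hw)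
  intro e he
  have hval : ∀ a, W a e.1 = a e / (e.1.2 + 1) := by
    intro a
    simp only [W, Finsupp.finsetSum_apply]
    rw [Finset.sum_eq_single e]
    · simp
    · intro b _ hne
      exact Finsupp.single_eq_of_ne fun h => hne (Subtype.ext h.symm)
    · exact fun h => absurd he h
  have h1 := DFunLike.congr_fun key e.1
  rw [hval, hval, div_left_inj' (by positivity)] at h1
  have := max_zero_sub_max_neg_zero_eq_self (w e)
  rw [h1, sub_self] at this
  exact this.symm

theorem Embedded.affineIndependent_vertexFinset {l m : List RatPointCode} (hm : m ∈ L)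
    (hlm : l.Sublist m) : AffineIndependent ℝ ((↑) : vertexFinset n l → (Fin n → ℝ)) := by
  refine ((hL.affineIndependent hm).range).mono (t := Set.range fun v : {v // v ∈ m} =>
    v.1.toPoint n) fun x hx => ?_
  rw [Finset.mem_coe, mem_vertexFinset] at hx
  obtain ⟨p, hp, rfl⟩ := hx
  exact ⟨⟨p, hlm.subset hp⟩, rfl⟩

/-- A common point has the same weights in both cells, hence weights supported on the common
vertices. -/
theorem Embedded.convexHull_inter {l l' m m' : List RatPointCode} (hm : m ∈ L) (hm' : m' ∈ L)
    (hlm : l.Sublist m) (hlm' : l'.Sublist m') :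
    convexHull ℝ (vertexFinset n l : Set (Fin n → ℝ)) ∩ convexHull ℝ (vertexFinset n l') ⊆
      convexHull ℝ ((vertexFinset n l : Set (Fin n → ℝ)) ∩ vertexFinset n l') := by
  rintro x ⟨hx, hx'⟩
  obtain ⟨w, hw, hwx⟩ := mem_convexHull_vertexFinset.1 hx
  obtain ⟨w', hw', hwx'⟩ := mem_convexHull_vertexFinset.1 hx'
  have := hL m hm m' hm' w (weights_mono hlm.subset hw) w' (weights_mono hlm'.subset hw')
    (hwx.trans hwx'.symm)
  subst this
  have hmem : x ∈ convexHull ℝ (vertexFinset n (l.filter (· ∈ l')) : Set (Fin n → ℝ)) :=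
    mem_convexHull_vertexFinset.2 ⟨w, ⟨hw.1, fun v hv => List.mem_filter.2
      ⟨hw.2 v hv, by simpa using hw'.2 v hv⟩⟩, hwx⟩
  refine convexHull_mono (fun y hy => ?_) hmem
  rw [Finset.mem_coe, mem_vertexFinset] at hy
  obtain ⟨p, hp, rfl⟩ := hy
  rw [List.mem_filter, decide_eq_true_iff] at hp
  exact ⟨mem_vertexFinset.2 ⟨p, hp.1, rfl⟩, mem_vertexFinset.2 ⟨p, hp.2, rfl⟩⟩

end Embedded

section Complex

variable {n : ℕ} {L : List (List RatPointCode)}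

/-- The simplicial complex given by a list of cells. -/
noncomputable def complex (hL : Embedded (homPoint n) L) :
    Geometry.SimplicialComplex ℝ (Fin n → ℝ) where
  faces := vertexSets n (facesCode L)
  isRelLowerSet_faces := by
    intro s hs
    obtain ⟨l, hl, rfl⟩ := mem_vertexSets_iff.1 hs
    obtain ⟨hne, m, hm, hlm⟩ := mem_facesCode.1 hl
    refine ⟨?_, fun s hs hs0 => ?_⟩
    · obtain ⟨v, hv⟩ := List.exists_mem_of_ne_nil l hne
      exact ⟨_, mem_vertexFinset.2 ⟨v, hv, rfl⟩⟩
    · classical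
      have hs' : s = vertexFinset n (l.filter fun v => decide (v.toPoint n ∈ s)) := by
        ext x
        rw [mem_vertexFinset]
        constructor
        · intro hx
          obtain ⟨p, hp, rfl⟩ := mem_vertexFinset.1 (hs hx)
          exact ⟨p, List.mem_filter.2 ⟨hp, by simpa using hx⟩, rfl⟩
        · rintro ⟨p, hp, rfl⟩
          simpa using (List.mem_filter.1 hp).2
      refine mem_vertexSets_iff.2 ⟨_, mem_facesCode.2 ⟨fun h => ?_, m, hm,
        List.filter_sublist.trans hlm⟩, hs'⟩
      rw [hs', h] at hs0
      simp [vertexFinset] at hs0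
  indep := by
    intro s hs
    obtain ⟨l, hl, rfl⟩ := mem_vertexSets_iff.1 hs
    obtain ⟨-, m, hm, hlm⟩ := mem_facesCode.1 hl
    exact hL.affineIndependent_vertexFinset hm hlm
  inter_subset_convexHull := by
    intro s s' hs hs'
    obtain ⟨l, hl, rfl⟩ := mem_vertexSets_iff.1 hs
    obtain ⟨-, m, hm, hlm⟩ := mem_facesCode.1 hl
    obtain ⟨l', hl', rfl⟩ := mem_vertexSets_iff.1 hs'
    obtain ⟨-, m', hm', hlm'⟩ := mem_facesCode.1 hl'
    exact hL.convexHull_inter hm hm' hlm hlm'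

theorem mem_space_complex (hL : Embedded (homPoint n) L) {x : Fin n → ℝ} :
    x ∈ (complex hL).space ↔ (x, (1 : ℝ)) ∈ cone (homPoint n) L := by
  rw [Geometry.SimplicialComplex.mem_space_iff]
  constructor
  · rintro ⟨s, hs, hx⟩
    obtain ⟨l, hl, rfl⟩ := mem_vertexSets_iff.1 hs
    obtain ⟨-, m, hm, hlm⟩ := mem_facesCode.1 hl
    obtain ⟨w, hw, hwx⟩ := mem_convexHull_vertexFinset.1 hx
    exact ⟨m, hm, w, weights_mono hlm.subset hw, hwx⟩
  · rintro ⟨l, hl, w, hw, hwx⟩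
    refine ⟨_, mem_vertexSets_iff.2 ⟨l, mem_facesCode.2 ⟨?_, l, hl, List.Sublist.refl _⟩, rfl⟩,
      mem_convexHull_vertexFinset.2 ⟨w, hw, hwx⟩⟩
    -- The empty cell spans only the origin, which is not at height 1.
    rintro rfl
    have : w = 0 := by
      ext v
      by_contra h
      exact List.not_mem_nil (hw.2 v h)
    subst this
    have := congrArg Prod.snd hwx
    simp [bary] at this

theorem finite_faces_complex (hL : Embedded (homPoint n) L) : (complex hL).faces.Finite := by
  refine ((facesCode L).toFinset.finite_toSet.image (vertexFinset n)).subset fun s hs => ?_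
  obtain ⟨l, hl, rfl⟩ := mem_vertexSets_iff.1 hs
  exact ⟨l, by simpa using hl, rfl⟩

theorem exists_facet_of_finite {E : Type*} [AddCommGroup E] [Module ℝ E]
    {K : Geometry.SimplicialComplex ℝ E} (hK : K.faces.Finite) {s : Finset E} (hs : s ∈ K.faces) :
    ∃ u ∈ K.facets, s ⊆ u := by
  obtain ⟨u, hu, hu'⟩ := hK.exists_le_maximal hs
  exact ⟨u, ⟨hu'.1, fun t ht hut => hut.antisymm (hu'.2 ht hut)⟩, hu⟩

/-- Links the computable test to the geometry: vertices of a face have distinct codes and positions,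
so its length is its number of vertices, and by finiteness every face lies in a facet. -/
theorem isPure_iff (hL : Embedded (homPoint n) L) (hn : ∀ l ∈ L, l.Nodup) :
    IsPure n (facesCode L) ↔ ∀ s ∈ (complex hL).facets, s.card = n + 1 := by
  have hcard : ∀ l ∈ facesCode L, (vertexFinset n l).card = l.length := by
    intro l hl
    obtain ⟨-, m, hm, hlm⟩ := mem_facesCode.1 hl
    rw [vertexFinset, Finset.card_image_of_injOn, List.toFinset_card_of_nodup (hlm.nodup (hn m hm))]
    intro p hp q hq h
    exact hL.eq_of_toPoint_eq hm hm (hlm.subset (by simpa using hp)) (hlm.subset (by simpa using hq)) h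
  constructor
  · intro h s hs
    obtain ⟨l, hl, rfl⟩ := mem_vertexSets_iff.1 hs.1
    obtain ⟨m, hm, hlen, hlm⟩ := h l hl
    rw [hs.2 (mem_vertexSets_iff.2 ⟨m, hm, rfl⟩) fun x hx => ?_, hcard m hm, hlen]
    obtain ⟨p, hp, rfl⟩ := mem_vertexFinset.1 hx
    exact mem_vertexFinset.2 ⟨p, hlm p hp, rfl⟩
  · intro h l hl
    obtain ⟨u, hu, hlu⟩ := exists_facet_of_finite (finite_faces_complex hL)
      (mem_vertexSets_iff.2 ⟨l, hl, rfl⟩)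
    have hu' := h u hu
    obtain ⟨m, hm, rfl⟩ := mem_vertexSets_iff.1 hu.1
    refine ⟨m, hm, (hcard m hm).symm.trans hu', fun v hv => ?_⟩
    obtain ⟨p, hp, hpv⟩ := mem_vertexFinset.1 (hlu (mem_vertexFinset.2 ⟨v, hv, rfl⟩))
    obtain ⟨-, k, hk, hlk⟩ := mem_facesCode.1 hl
    obtain ⟨-, k', hk', hmk'⟩ := mem_facesCode.1 hm
    rw [← hL.eq_of_toPoint_eq hk' hk (hmk'.subset hp) (hlk.subset hv) hpv]
    exact hp

end Complex

theorem mem_fixedSet_iff {t : List MVTerm} {y : Fin t.length → ℝ} :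
    y ∈ fixedSet t ↔ (y, (1 : ℝ)) ∈ cubeCone t.length ∧
      ∀ i, homEval t.length (t.get i) (y, 1) = y i := by
  constructor
  · rintro ⟨x, hx, rfl⟩
    exact ⟨mem_cubeCone_of_mem x, fun i => by rw [← hatMap_apply, hx]⟩
  · rintro ⟨h1, h2⟩
    let x : Fin t.length → I := fun i => ⟨y i, h1.2 i⟩
    refine ⟨x, funext fun i => Subtype.ext ?_, rfl⟩
    rw [hatMap_apply]
    exact h2 i

theorem space_complex_fixedCode {t : List MVTerm} (ht : ∀ s ∈ t, s.VarsBelow t.length) :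
    (complex (fixedCode_spec ht).1).space = fixedSet t := by
  ext y
  rw [mem_space_complex, (fixedCode_spec ht).2.2, mem_fixedSet_iff]
  rfl

end ConeComplex

/-! ### The Poincaré–Miranda theorem -/

namespace PoincareMiranda

variable {n : ℕ}

/-- The alternating sum over the chains of lattice points starting at `z`, with steps in the
directions of `S`, of the products of the increments of the given functions: an iterated cup product
of coboundaries. -/
def cochain : List ((Fin n → ℕ) → ZMod 2) → Finset (Fin n) → (Fin n → ℕ) → ZMod 2
  | [], _, _ => 1
  | a :: as, S, z => ∑ i ∈ S, (a (z + Pi.single i 1) * cochain as (S.erase i) (z + Pi.single i 1) +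
      a z * cochain as (S.erase i) z)

/-- Exchanging the two indices pairs off the terms, and each pair cancels modulo 2. -/
theorem sum_offDiag_symm (S : Finset (Fin n)) (g : Fin n → Fin n → ZMod 2)
    (hg : ∀ i j, g i j = g j i) : ∑ i ∈ S, ∑ j ∈ S.erase i, g i j = 0 := by
  rw [Finset.sum_sigma']
  refine Finset.sum_involution (fun x _ => ⟨x.2, x.1⟩) ?_ ?_ ?_ ?_
  · rintro ⟨i, j⟩ -
    rw [hg j i]
    exact CharTwo.add_self_eq_zero _
  · rintro ⟨i, j⟩ h - h'
    simp only [Finset.mem_sigma, Finset.mem_erase] at h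
    exact h.2.1 (congrArg Sigma.fst h')
  · rintro ⟨i, j⟩ h
    simp only [Finset.mem_sigma, Finset.mem_erase] at h ⊢
    exact ⟨h.2.2, h.2.1.symm, h.1⟩
  · rintro ⟨i, j⟩ -
    rfl

/-- This is δδ = 0: for a nonempty list `cochain` is a coboundary, and expanding its coboundary
gives an expression symmetric in the two directions removed. -/
theorem cochain_closed (as : List ((Fin n → ℕ) → ZMod 2)) (S : Finset (Fin n)) (z : Fin n → ℕ) :
    ∑ i ∈ S, (cochain as (S.erase i) (z + Pi.single i 1) + cochain as (S.erase i) z) = 0 := by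
  cases as with
  | nil => exact Finset.sum_eq_zero fun _ _ => CharTwo.add_self_eq_zero _
  | cons a as =>
    simp only [cochain, ← Finset.sum_add_distrib]
    refine sum_offDiag_symm S (fun i j =>
      a (z + Pi.single i 1 + Pi.single j 1) *
        cochain as ((S.erase i).erase j) (z + Pi.single i 1 + Pi.single j 1) +
      a (z + Pi.single i 1) * cochain as ((S.erase i).erase j) (z + Pi.single i 1) +
      (a (z + Pi.single j 1) * cochain as ((S.erase i).erase j) (z + Pi.single j 1) +
      a z * cochain as ((S.erase i).erase j) z)) fun i j => ?_
    rw [Finset.erase_right_comm, add_right_comm z]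
    ring

/-- The Leibniz rule δ(a·c) = δa ∪ c + a·δc, with δc = 0. The definition as a coboundary suits
summation over the grid; this product form detects increments. -/
theorem cochain_cons (a : (Fin n → ℕ) → ZMod 2) (as : List ((Fin n → ℕ) → ZMod 2))
    (S : Finset (Fin n)) (z : Fin n → ℕ) :
    cochain (a :: as) S z = ∑ i ∈ S, (a (z + Pi.single i 1) + a z) *
      cochain as (S.erase i) (z + Pi.single i 1) := by
  have h : cochain (a :: as) S z = ∑ i ∈ S, (a (z + Pi.single i 1) + a z) *
      cochain as (S.erase i) (z + Pi.single i 1) + a z * ∑ i ∈ S,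
        (cochain as (S.erase i) (z + Pi.single i 1) + cochain as (S.erase i) z) := by
    rw [cochain, Finset.mul_sum, ← Finset.sum_add_distrib]
    refine Finset.sum_congr rfl fun i _ => ?_
    have := CharTwo.add_self_eq_zero (a z * cochain as (S.erase i) (z + Pi.single i 1))
    linear_combination (-1) * this
  rw [h, cochain_closed, mul_zero, add_zero]

/-- Some chain in the cell has a nonzero product of increments, so each function changes along one
of its steps. -/
theorem exists_increment {as : List ((Fin n → ℕ) → ZMod 2)} {S : Finset (Fin n)} {z : Fin n → ℕ}
    (h : cochain as S z ≠ 0) : ∀ a ∈ as, ∃ y y' : Fin n → ℕ, a y ≠ a y' ∧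
      (∀ j, z j ≤ y j ∧ y j ≤ z j + 1 ∧ z j ≤ y' j ∧ y' j ≤ z j + 1) ∧
        ∀ j ∉ S, y j = z j ∧ y' j = z j := by
  induction as generalizing S z with
  | nil => simp
  | cons b as ih =>
    rw [cochain_cons] at h
    obtain ⟨i, hi, h⟩ := Finset.exists_ne_zero_of_sum_ne_zero h
    have h1 := left_ne_zero_of_mul h
    have h2 := right_ne_zero_of_mul h
    have hsingle : ∀ j, (Pi.single i 1 : Fin n → ℕ) j = if j = i then 1 else 0 := fun j =>
      Pi.single_apply _ _ _
    intro a ha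
    rcases List.mem_cons.1 ha with rfl | ha
    · refine ⟨z + Pi.single i 1, z, fun h => h1 (by rw [h]; exact CharTwo.add_self_eq_zero _),
        fun j => ?_, fun j hj => ?_⟩
      · simp only [Pi.add_apply, hsingle]
        split_ifs <;> omega
      · have : j ≠ i := fun h => hj (h ▸ hi)
        simp [this]
    · obtain ⟨y, y', hne, h3, h4⟩ := ih h2 a ha
      refine ⟨y, y', hne, fun j => ?_, fun j hj => ?_⟩
      · have h3 := h3 j
        have h4 := h4 j
        simp only [Pi.add_apply, hsingle, Finset.mem_erase] at h3 h4
        split_ifs at h3 h4 with hji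
        · have := h4 fun h => h.1 hji
          omega
        · omega
      · have hji : j ≠ i := fun h => hj (h ▸ hi)
        have h4 := h4 j fun h => hj (Finset.mem_of_mem_erase h)
        simpa [hji] using h4

theorem sum_piFinset_update (s : Fin n → Finset ℕ) (i : Fin n) (T : Finset ℕ)
    (g : (Fin n → ℕ) → ZMod 2) :
    ∑ z ∈ Fintype.piFinset (Function.update s i T), g z =
      ∑ w ∈ Fintype.piFinset (Function.update s i {0}), ∑ m ∈ T, g (Function.update w i m) := by
  rw [← Finset.sum_product']
  refine Finset.sum_nbij' (fun z => (Function.update z i 0, z i))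
    (fun x => Function.update x.1 i x.2) ?_ ?_ ?_ ?_ ?_
  · intro z hz
    rw [Fintype.mem_piFinset] at hz
    rw [Finset.mem_product, Fintype.mem_piFinset]
    refine ⟨fun j => ?_, by simpa using hz i⟩
    have := hz j
    by_cases hj : j = i
    · subst hj; simp
    · simpa [hj] using this
  · rintro ⟨w, m⟩ h
    rw [Finset.mem_product, Fintype.mem_piFinset] at h
    rw [Fintype.mem_piFinset]
    intro j
    have := h.1 j
    by_cases hj : j = i
    · subst hj; simpa using h.2
    · simpa [hj] using this
  · intro z _
    simp
  · rintro ⟨w, m⟩ h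
    rw [Finset.mem_product, Fintype.mem_piFinset] at h
    have := h.1 i
    simp only [Function.update_self, Finset.mem_singleton] at this
    simp [← this]
  · intro z _
    simp

theorem sum_telescope (s : Fin n → Finset ℕ) (i : Fin n) {N : ℕ} (hs : s i = Finset.range N)
    (f : (Fin n → ℕ) → ZMod 2) :
    ∑ z ∈ Fintype.piFinset s, (f (z + Pi.single i 1) + f z) =
      ∑ z ∈ Fintype.piFinset (Function.update s i {N}), f z +
        ∑ z ∈ Fintype.piFinset (Function.update s i {0}), f z := by
  conv_lhs => rw [← Function.update_eq_self i s]
  rw [sum_piFinset_update, sum_piFinset_update s i {N}, ← Finset.sum_add_distrib, hs]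
  refine Finset.sum_congr rfl fun w hw => ?_
  have hw0 : Function.update w i 0 = w := by
    rw [Fintype.mem_piFinset] at hw
    have := hw i
    simp only [Function.update_self, Finset.mem_singleton] at this
    rw [← this, Function.update_eq_self]
  have hstep : ∀ m, Function.update w i m + Pi.single i 1 = Function.update w i (m + 1) := by
    intro m
    ext j
    by_cases hj : j = i
    · subst hj; simp
    · simp [hj]
  simp only [hstep, Finset.sum_singleton]
  conv_rhs => rw [← hw0]
  rw [Function.update_idem]
  clear hs
  induction N with
  | zero => simp [CharTwo.add_self_eq_zero]
  | succ N ih =>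
    rw [Finset.sum_range_succ, ih]
    have := CharTwo.add_self_eq_zero (f (Function.update w i N))
    linear_combination this

/-- Stokes modulo 2, by induction on the dimension: the sum of a coboundary over the grid reduces to
the boundary faces. Of these, only the face z_k = N contributes, where `a k = 1` leaves the sum for
the remaining directions. -/
theorem sum_cochain {N : ℕ} (a : Fin n → (Fin n → ℕ) → ZMod 2)
    (h0 : ∀ i z, z i = 0 → a i z = 0) (h1 : ∀ i z, z i = N → a i z = 1)
    (l : List (Fin n)) (hl : l.Nodup) :
    ∑ z ∈ Fintype.piFinset (fun j => if j ∈ l then Finset.range N else {N}),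
      cochain (l.map a) l.toFinset z = 1 := by
  induction l with
  | nil =>
    simp only [List.not_mem_nil, if_false, Fintype.piFinset_singleton, Finset.sum_singleton]
    rfl
  | cons k l ih =>
    have hk : k ∉ l := (List.nodup_cons.1 hl).1
    simp only [List.map_cons, cochain]
    rw [Finset.sum_comm, Finset.sum_eq_single k]
    · rw [sum_telescope (N := N) _ k (by simp)
        (fun z => a k z * cochain (l.map a) ((k :: l).toFinset.erase k) z)]
      have e1 : Function.update (fun j => if j ∈ k :: l then Finset.range N else {N}) k {N} =
          fun j => if j ∈ l then Finset.range N else {N} := by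
        ext1 j
        by_cases hj : j = k
        · subst hj; simp [hk]
        · simp [hj]
      have e2 : (k :: l).toFinset.erase k = l.toFinset := by
        rw [List.toFinset_cons, Finset.erase_insert (by simpa using hk)]
      rw [e1, e2, ← ih (List.nodup_cons.1 hl).2]
      refine (congrArg₂ (· + ·) (Finset.sum_congr rfl fun z hz => ?_)
        (Finset.sum_eq_zero fun z hz => ?_)).trans (add_zero _)
      · have := Fintype.mem_piFinset.1 hz k
        rw [h1 k z (by simpa [hk] using this), one_mul]
      · have := Fintype.mem_piFinset.1 hz k
        rw [h0 k z (by simpa using this), zero_mul]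
    · intro i hi hik
      have hil : i ∈ l := by simpa [hik] using hi
      rw [sum_telescope (N := N) _ i (by simp [hil])
        (fun z => a k z * cochain (l.map a) ((k :: l).toFinset.erase i) z)]
      -- On a face orthogonal to the direction i, the function `a i` is constant but still occurs as
      -- a factor, so the cochain vanishes.
      have key : ∀ c, (∀ z z' : Fin n → ℕ, z i = c → z' i = c → a i z = a i z') →
          ∑ z ∈ Fintype.piFinset (Function.update (fun j => if j ∈ k :: l then Finset.range N
            else {N}) i {c}), a k z * cochain (l.map a) ((k :: l).toFinset.erase i) z = 0 := by
        intro c hc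
        refine Finset.sum_eq_zero fun z hz => ?_
        have hz := Fintype.mem_piFinset.1 hz i
        simp only [Function.update_self, Finset.mem_singleton] at hz
        by_contra h
        obtain ⟨y, y', hne, -, h2⟩ := exists_increment (right_ne_zero_of_mul h) (a i)
          (List.mem_map_of_mem hil)
        have := h2 i (by simp)
        exact hne (hc y y' (this.1.trans hz) (this.2.trans hz))
      rw [key N fun z z' hz hz' => by rw [h1 i z hz, h1 i z' hz'],
        key 0 fun z z' hz hz' => by rw [h0 i z hz, h0 i z' hz'], add_zero]
    · intro h
      simp at h

theorem exists_cell {N : ℕ} (a : Fin n → (Fin n → ℕ) → ZMod 2)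
    (h0 : ∀ i z, z i = 0 → a i z = 0) (h1 : ∀ i z, z i = N → a i z = 1) :
    ∃ z : Fin n → ℕ, ∀ i, ∃ y y' : Fin n → ℕ, a i y ≠ a i y' ∧
      ∀ j, z j ≤ y j ∧ y j ≤ z j + 1 ∧ z j ≤ y' j ∧ y' j ≤ z j + 1 := by
  have h := sum_cochain a h0 h1 (List.finRange n) (List.nodup_finRange n)
  obtain ⟨z, -, hz⟩ := Finset.exists_ne_zero_of_sum_ne_zero (by rw [h]; exact one_ne_zero)
  refine ⟨z, fun i => ?_⟩
  obtain ⟨y, y', h2, h3, -⟩ := exists_increment hz (a i)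
    (List.mem_map_of_mem (List.mem_finRange i))
  exact ⟨y, y', h2, h3⟩

/-- The lattice point `z / N`, moved to the cube. -/
noncomputable def gridPoint (N : ℕ) (z : Fin n → ℕ) : Fin n → I := fun j =>
  Set.projIcc 0 1 zero_le_one ((z j : ℝ) / N)

theorem dist_gridPoint_le (N : ℕ) {z y : Fin n → ℕ} (h : ∀ j, z j ≤ y j ∧ y j ≤ z j + 1) :
    dist (gridPoint N y) (gridPoint N z) ≤ 1 / N := by
  refine (dist_pi_le_iff (by positivity)).2 fun j => ?_
  refine ((LipschitzWith.projIcc zero_le_one).dist_le_mul _ _).trans ?_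
  rw [NNReal.coe_one, one_mul, Real.dist_eq, ← sub_div, abs_div, Nat.abs_cast]
  refine div_le_div_of_nonneg_right ?_ (Nat.cast_nonneg N)
  have h1 : (z j : ℝ) ≤ y j := by exact_mod_cast (h j).1
  have h2 : (y j : ℝ) ≤ z j + 1 := by exact_mod_cast (h j).2
  rw [abs_le]
  constructor <;> linarith

/-- Label grid points by the signs of the coordinates of F. `exists_cell` gives a cell on which
every coordinate changes sign; for a fine grid the norm of F there is below its minimum over the
cube, which is positive if F has no zero. -/
theorem exists_eq_zero {F : (Fin n → I) → Fin n → ℝ} (hF : Continuous F)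
    (h0 : ∀ x i, x i = 0 → F x i < 0) (h1 : ∀ x i, x i = 1 → 0 < F x i) : ∃ x, F x = 0 := by
  by_contra! hne
  obtain ⟨x₀, -, hx₀⟩ := isCompact_univ.exists_isMinOn (Set.univ_nonempty (α := Fin n → I))
    hF.norm.continuousOn
  have hδ : 0 < ‖F x₀‖ := norm_pos_iff.2 (hne x₀)
  obtain ⟨η, hη, hη'⟩ := Metric.uniformContinuous_iff.1
    (CompactSpace.uniformContinuous_of_continuous hF) _ hδ
  obtain ⟨N, hN⟩ := exists_nat_one_div_lt hη
  classical
  let a : Fin n → (Fin n → ℕ) → ZMod 2 := fun i z =>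
    if 0 < F (gridPoint (N + 1) z) i then 1 else 0
  obtain ⟨z, hz⟩ := exists_cell (N := N + 1) a (fun i z hz => if_neg (not_lt.2 (h0 _ i (by
      simp only [gridPoint, hz, Nat.cast_zero, zero_div]
      exact Set.projIcc_left _)).le))
    fun i z hz => if_pos (h1 _ i (by
      have : ((N + 1 : ℕ) : ℝ) ≠ 0 := by positivity
      simp only [gridPoint, hz, div_self this]
      exact Set.projIcc_right _))
  have hlt : ‖F (gridPoint (N + 1) z)‖ < ‖F x₀‖ := by
    refine (pi_norm_lt_iff hδ).2 fun i => ?_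
    obtain ⟨y, y', hne, hy⟩ := hz i
    have hdist : ∀ y : Fin n → ℕ, (∀ j, z j ≤ y j ∧ y j ≤ z j + 1) →
        |F (gridPoint (N + 1) y) i - F (gridPoint (N + 1) z) i| < ‖F x₀‖ := by
      intro y hy
      have h2 := hη' ((dist_gridPoint_le (N + 1) hy).trans_lt (by exact_mod_cast hN))
      exact (dist_pi_lt_iff hδ).1 h2 i
    have h2 := abs_lt.1 (hdist y fun j => ⟨(hy j).1, (hy j).2.1⟩)
    have h3 := abs_lt.1 (hdist y' fun j => ⟨(hy j).2.2.1, (hy j).2.2.2⟩)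
    rw [Real.norm_eq_abs, abs_lt]
    simp only [a] at hne
    split_ifs at hne with h4 h5 h5
    · exact absurd rfl hne
    · constructor <;> linarith
    · constructor <;> linarith
    · exact absurd rfl hne
  exact absurd (hx₀ (Set.mem_univ (gridPoint (N + 1) z))) (not_le.2 hlt)

end PoincareMiranda

/-! ### Invariance of dimension -/

/-- The cube of dimension `n` does not embed in a space of smaller dimension. -/
theorem not_injective_of_finrank_lt {n : ℕ} {W : Type*} [NormedAddCommGroup W] [NormedSpace ℝ W]
    [FiniteDimensional ℝ W] (hW : Module.finrank ℝ W < n) {ψ : (Fin n → I) → W}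
    (hψ : Continuous ψ) : ¬ Function.Injective ψ := by
  intro hinj
  -- The functions factoring through ψ by a C¹ function on W. If ψ is injective they separate
  -- points, and Stone–Weierstrass applies.
  let A : Subalgebra ℝ C(Fin n → I, ℝ) :=
    { carrier := {f | ∃ g : W → ℝ, ContDiff ℝ 1 g ∧ ∀ x, f x = g (ψ x)}
      mul_mem' := by
        rintro f f' ⟨g, hg, h⟩ ⟨g', hg', h'⟩
        exact ⟨fun x => g x * g' x, hg.mul hg', fun x => by simp [h, h']⟩
      add_mem' := by
        rintro f f' ⟨g, hg, h⟩ ⟨g', hg', h'⟩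
        exact ⟨fun x => g x + g' x, hg.add hg', fun x => by simp [h, h']⟩
      algebraMap_mem' := fun r => ⟨fun _ => r, contDiff_const, fun x => rfl⟩ }
  have hA : A.SeparatesPoints := by
    intro x y hxy
    obtain ⟨f, hf⟩ := SeparatingDual.exists_separating_of_ne (R := ℝ) (hinj.ne hxy)
    exact ⟨_, ⟨⟨fun x => f (ψ x), f.continuous.comp hψ⟩, ⟨f, f.contDiff, fun _ => rfl⟩, rfl⟩, hf⟩
  have happrox : ∀ i : Fin n, ∃ g : W → ℝ, ContDiff ℝ 1 g ∧
      ∀ x : Fin n → I, |g (ψ x) - ((x i : ℝ) - 1 / 2)| < 1 / 4 := by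
    intro i
    obtain ⟨⟨f, g, hg, hfg⟩, hf⟩ :=
      ContinuousMap.exists_mem_subalgebra_near_continuous_of_separatesPoints A hA
        (fun x => (x i : ℝ) - 1 / 2) (by fun_prop) (1 / 4) (by norm_num)
    exact ⟨g, hg, fun x => by rw [← hfg]; exact hf x⟩
  choose g hg hgx using happrox
  -- A C¹ map into a space of larger dimension misses a dense set, hence a value c with coordinates
  -- below 1/4.
  have hdense := ContDiff.dense_compl_range_of_finrank_lt_finrank
    (f := fun w i => g i w) (contDiff_pi.2 hg) (by simpa using hW)
  obtain ⟨c, hc, hc'⟩ := Metric.dense_iff.1 hdense 0 (1 / 4) (by norm_num)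
  have hci : ∀ i, |c i| < 1 / 4 := fun i => by
    have := (pi_norm_lt_iff (by norm_num)).1 (mem_ball_zero_iff.1 hc) i
    exact this
  -- The two errors of 1/4 total less than 1/2, the absolute value of x_i - 1/2 on the faces, so the
  -- signs there are right. The resulting zero shows that c is attained.
  obtain ⟨x, hx⟩ := PoincareMiranda.exists_eq_zero (F := fun x i => g i (ψ x) - c i)
    (continuous_pi fun i => ((hg i).continuous.comp hψ).sub continuous_const)
    (fun x i hx => by
      have h1 := abs_lt.1 (hgx i x)
      have h2 := abs_lt.1 (hci i)
      rw [hx, Set.Icc.coe_zero] at h1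
      linarith)
    (fun x i hx => by
      have h1 := abs_lt.1 (hgx i x)
      have h2 := abs_lt.1 (hci i)
      rw [hx, Set.Icc.coe_one] at h1
      linarith)
  exact hc' ⟨ψ x, funext fun i => sub_eq_zero.1 (congrFun hx i)⟩

/-! ### Polyhedra that are homeomorphic to closed domains -/

section ClosedDomain

variable {n : ℕ}

theorem continuous_coe_cube : Continuous fun (x : Fin n → I) i => (x i : ℝ) := by fun_prop

theorem isInducing_coe_cube : Topology.IsInducing fun (x : Fin n → I) i => (x i : ℝ) :=
  Topology.IsInducing.piMap fun _ => Topology.IsInducing.subtypeVal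

/-- A nonempty open subset of the cube contains a small cube. -/
theorem exists_injective_of_isOpen {G : Set (Fin n → I)} (hG : IsOpen G) (hne : G.Nonempty) :
    ∃ f : (Fin n → I) → (Fin n → I), Continuous f ∧ Function.Injective f ∧ ∀ x, f x ∈ G := by
  obtain ⟨x, hx⟩ := hne
  obtain ⟨ε, hε, hball⟩ := Metric.isOpen_iff.1 hG x hx
  -- The cube is contracted towards x: δ ≤ 1 keeps it inside the cube, δ ≤ ε/2 inside the ball.
  set δ := min (ε / 2) 1 with hδ
  have hδ0 : 0 < δ := lt_min (by linarith) one_pos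
  have hδ1 : δ ≤ 1 := min_le_right _ _
  refine ⟨fun y i => ⟨(1 - δ) * x i + δ * y i, ?_, ?_⟩, ?_, ?_, fun y => hball ?_⟩
  · exact add_nonneg (mul_nonneg (by linarith) (x i).2.1) (mul_nonneg hδ0.le (y i).2.1)
  · nlinarith [(x i).2.2, (y i).2.2]
  · fun_prop
  · intro y y' h
    funext i
    have := congrArg Subtype.val (congrFun h i)
    simp only [add_right_inj] at this
    exact Subtype.ext (mul_left_cancel₀ hδ0.ne' this)
  · refine (dist_pi_lt_iff hε).2 fun i => ?_
    rw [Subtype.dist_eq, Real.dist_eq]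
    have h1 : (1 - δ) * (x i : ℝ) + δ * y i - x i = δ * (y i - x i) := by ring
    rw [h1, abs_mul, abs_of_pos hδ0]
    have h2 : |(y i : ℝ) - x i| ≤ 1 := by
      rw [abs_le]
      constructor <;> linarith [(x i).2.1, (x i).2.2, (y i).2.1, (y i).2.2]
    have h3 : δ ≤ ε / 2 := min_le_left _ _
    nlinarith

variable {K : Geometry.SimplicialComplex ℝ (Fin n → ℝ)}

/-- The barycenter of a facet is in no other face. -/
theorem centroid_notMem_convexHull {s t : Finset (Fin n → ℝ)} (hs : s ∈ K.facets) (ht : t ∈ K.faces)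
    (hst : t ≠ s) : s.centerMass (fun _ => (1 : ℝ)) id ∉ convexHull ℝ (t : Set (Fin n → ℝ)) := by
  classical
  have hne := K.nonempty_of_mem_faces hs.1
  have hcard : (0 : ℝ) < s.card := by exact_mod_cast hne.card_pos
  intro hmem
  have hc : s.centerMass (fun _ => (1 : ℝ)) id ∈ convexHull ℝ (s : Set (Fin n → ℝ)) :=
    s.centerMass_mem_convexHull (fun _ _ => zero_le_one) (by simpa using hcard) fun _ h => h
  have h1 := K.inter_subset_convexHull hs.1 ht ⟨hc, hmem⟩
  rw [← Finset.coe_inter, Finset.mem_convexHull'] at h1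
  obtain ⟨w, hw0, hw1, hw⟩ := h1
  obtain ⟨v, hvs, hvt⟩ : ∃ v ∈ s, v ∉ t := by
    by_contra! h
    exact hst (hs.2 ht h).symm
  -- The difference of two barycentric coordinate vectors of the barycenter: an affine relation
  -- among the vertices of s, nonzero at the vertex v outside t.
  let u : (Fin n → ℝ) → ℝ := fun y => (if y ∈ t then w y else 0) - 1 / s.card
  have hsum : ∀ g : (Fin n → ℝ) → (Fin n → ℝ),
      ∑ y ∈ s, (if y ∈ t then w y else 0) • g y = ∑ y ∈ s ∩ t, w y • g y := by
    intro g
    simp only [ite_smul, zero_smul]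
    rw [← Finset.sum_filter, Finset.filter_mem_eq_inter]
  have hu0 : ∑ y : s, u y = 0 := by
    rw [Finset.sum_coe_sort s u, Finset.sum_sub_distrib, ← Finset.sum_filter,
      Finset.filter_mem_eq_inter, hw1, Finset.sum_const, nsmul_eq_mul, mul_one_div_cancel hcard.ne',
      sub_self]
  have hu1 : ∑ y : s, u y • (y : Fin n → ℝ) = 0 := by
    rw [Finset.sum_coe_sort s fun y => u y • y]
    simp only [u, sub_smul, Finset.sum_sub_distrib]
    rw [hsum fun y => y, hw, Finset.centerMass]
    simp [Finset.smul_sum]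
  have := (affineIndependent_iff.1 (K.indep hs.1)) Finset.univ (fun y => u y) hu0 hu1 ⟨v, hvs⟩
    (Finset.mem_univ _)
  simp [u, hvt, hcard.ne'] at this

/-- Away from the other faces, a closed set missing the barycenter of `s`, the polyhedron is
contained in `s`. If `s` had too few vertices, a small n-cube in D would embed in the direction
space of `s`, of dimension below n. -/
theorem card_facet_of_homeomorph (hK : K.faces.Finite) {D : Set (Fin n → I)}
    (hD : IsClosedDomain D) (e : K.space ≃ₜ D) {s : Finset (Fin n → ℝ)} (hs : s ∈ K.facets) :
    s.card = n + 1 := by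
  classical
  have hne := K.nonempty_of_mem_faces hs.1
  have hind := K.indep hs.1
  have hcard : s.card ≤ n + 1 := by
    have := hind.card_le_finrank_succ
    rw [Fintype.card_coe] at this
    refine this.trans (Nat.succ_le_succ ?_)
    simpa using Submodule.finrank_le (vectorSpan ℝ (Set.range ((↑) : s → Fin n → ℝ)))
  by_contra hlt
  obtain ⟨k, hk⟩ : ∃ k, s.card = k + 1 := ⟨s.card - 1, by have := hne.card_pos; omega⟩
  let W := vectorSpan ℝ (Set.range ((↑) : s → Fin n → ℝ))
  have hW : Module.finrank ℝ W < n := by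
    have : Module.finrank ℝ W = k := hind.finrank_vectorSpan (by rw [Fintype.card_coe, hk])
    omega
  let C : Set (Fin n → ℝ) := ⋃ t ∈ K.faces \ {s}, convexHull ℝ (t : Set (Fin n → ℝ))
  have hC : IsClosed C := (hK.subset Set.sdiff_subset).isClosed_biUnion fun t _ =>
    (t.finite_toSet.isCompact_convexHull (𝕜 := ℝ)).isClosed
  have hsub : ∀ x ∈ K.space, x ∉ C → x ∈ convexHull ℝ (s : Set (Fin n → ℝ)) := by
    intro x hx hxC
    obtain ⟨t, ht, hxt⟩ := Geometry.SimplicialComplex.mem_space_iff.1 hx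
    by_cases hts : t = s
    · exact hts ▸ hxt
    · exact absurd (Set.mem_biUnion (show t ∈ K.faces \ {s} from ⟨ht, hts⟩) hxt) hxC
  set c := s.centerMass (fun _ => (1 : ℝ)) id
  have hcs : c ∈ convexHull ℝ (s : Set (Fin n → ℝ)) :=
    s.centerMass_mem_convexHull (fun _ _ => zero_le_one) (by simpa using hne.card_pos)
      fun _ h => h
  have hcK : c ∈ K.space := Geometry.SimplicialComplex.mem_space_iff.2 ⟨s, hs.1, hcs⟩
  have hcC : c ∉ C := by
    intro h
    obtain ⟨t, ht, hct⟩ := Set.mem_iUnion₂.1 h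
    exact centroid_notMem_convexHull hs ht.1 ht.2 hct
  have hU : IsOpen {d : D | (e.symm d : Fin n → ℝ) ∉ C} :=
    (hC.preimage (continuous_subtype_val.comp e.symm.continuous)).isOpen_compl
  obtain ⟨O, hO, hOU⟩ := isOpen_induced_iff.1 hU
  have hmem : ((e ⟨c, hcK⟩ : D) : Fin n → I) ∈ O := by
    have : e ⟨c, hcK⟩ ∈ Subtype.val ⁻¹' O := by
      rw [hOU]
      simpa using hcC
    exact this
  -- Here the closed domain enters: the image of the barycenter is in the closure of the interior.
  have hne' : (O ∩ interior D).Nonempty := by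
    exact mem_closure_iff.1 (hD.symm.subset (e ⟨c, hcK⟩).2) O hO hmem
  obtain ⟨f, hf, hfinj, hfG⟩ := exists_injective_of_isOpen (hO.inter isOpen_interior) hne'
  have hfD : ∀ x, f x ∈ D := fun x => interior_subset (hfG x).2
  let g : (Fin n → I) → (Fin n → ℝ) := fun x => e.symm ⟨f x, hfD x⟩
  have hg : Continuous g :=
    continuous_subtype_val.comp (e.symm.continuous.comp (hf.subtype_mk hfD))
  have hgs : ∀ x, g x ∈ convexHull ℝ (s : Set (Fin n → ℝ)) := by
    intro x
    refine hsub _ (e.symm ⟨f x, hfD x⟩).2 ?_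
    have : (⟨f x, hfD x⟩ : D) ∈ Subtype.val ⁻¹' O := (hfG x).1
    rw [hOU] at this
    exact this
  have hgW : ∀ x, g x - c ∈ W := by
    intro x
    have h1 : ∀ y ∈ convexHull ℝ (s : Set (Fin n → ℝ)),
        y ∈ affineSpan ℝ (Set.range ((↑) : s → Fin n → ℝ)) := by
      intro y hy
      rw [Subtype.range_coe_subtype]
      exact convexHull_subset_affineSpan _ hy
    have := AffineSubspace.vsub_mem_direction (h1 _ (hgs x)) (h1 _ hcs)
    rwa [direction_affineSpan] at this
  refine not_injective_of_finrank_lt hW (ψ := fun x => ⟨g x - c, hgW x⟩)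
    ((hg.sub continuous_const).subtype_mk _) fun x y hxy => ?_
  have h1 : g x = g y := by simpa using congrArg Subtype.val hxy
  have h2 := e.symm.injective (Subtype.ext h1)
  exact hfinj (congrArg Subtype.val h2)

/-- The part of a polyhedron in the cube. -/
def cubePart (K : Geometry.SimplicialComplex ℝ (Fin n → ℝ)) : Set (Fin n → I) :=
  {x | (fun i => (x i : ℝ)) ∈ K.space}

/-- A simplex with n + 1 vertices has nonempty interior and, being convex, is the closure of it;
such simplexes cover K. -/
theorem isClosedDomain_cubePart (hK : K.faces.Finite)
    (hcube : K.space ⊆ Set.range fun (x : Fin n → I) i => (x i : ℝ))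
    (hfull : ∀ s ∈ K.facets, s.card = n + 1) : IsClosedDomain (cubePart K) := by
  have hclosed : IsClosed K.space := hK.isClosed_biUnion fun t _ =>
    (t.finite_toSet.isCompact_convexHull (𝕜 := ℝ)).isClosed
  refine Set.Subset.antisymm
    (closure_minimal interior_subset (hclosed.preimage continuous_coe_cube)) fun x hx => ?_
  obtain ⟨s, hs, hxs⟩ := Geometry.SimplicialComplex.mem_space_iff.1 hx
  obtain ⟨u, hu, hsu⟩ := ConeComplex.exists_facet_of_finite hK hs
  have hxu := convexHull_mono (𝕜 := ℝ) (Finset.coe_subset.2 hsu) hxs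
  have hint : (interior (convexHull ℝ (u : Set (Fin n → ℝ)))).Nonempty := by
    rw [interior_convexHull_nonempty_iff_affineSpan_eq_top]
    have := (K.indep hu.1).affineSpan_eq_top_iff_card_eq_finrank_add_one.2
      (by rw [Fintype.card_coe, hfull u hu]; simp)
    rwa [Subtype.range_coe_subtype] at this
  have hcl := (convex_convexHull ℝ (u : Set (Fin n → ℝ))).closure_interior_eq_closure_of_nonempty_interior
    hint
  have huK : convexHull ℝ (u : Set (Fin n → ℝ)) ⊆ K.space :=
    Geometry.SimplicialComplex.convexHull_subset_space hu.1
  have hsub : (fun (x : Fin n → I) i => (x i : ℝ)) ⁻¹' interior (convexHull ℝ (u : Set (Fin n → ℝ)))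
      ⊆ interior (cubePart K) :=
    interior_maximal (fun y hy => huK (interior_subset hy))
      (isOpen_interior.preimage continuous_coe_cube)
  refine closure_mono hsub ?_
  rw [isInducing_coe_cube.closure_eq_preimage_closure_image, Set.mem_preimage,
    Set.image_preimage_eq_of_subset (interior_subset.trans (huK.trans hcube)), hcl]
  exact subset_closure hxu

theorem exists_closedDomain_homeomorph_iff (hK : K.faces.Finite)
    (hcube : K.space ⊆ Set.range fun (x : Fin n → I) i => (x i : ℝ)) :
    (∃ D : Set (Fin n → I), IsClosedDomain D ∧ Nonempty (K.space ≃ₜ D)) ↔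
      ∀ s ∈ K.facets, s.card = n + 1 := by
  constructor
  · rintro ⟨D, hD, ⟨e⟩⟩ s hs
    exact card_facet_of_homeomorph hK hD e hs
  · intro h
    refine ⟨cubePart K, isClosedDomain_cubePart hK hcube h, ⟨Homeomorph.symm ?_⟩⟩
    have hinj : Function.Injective fun (x : Fin n → I) i => (x i : ℝ) := fun x y hxy =>
      funext fun i => Subtype.ext (congrFun hxy i)
    refine ((Topology.IsEmbedding.mk isInducing_coe_cube hinj).homeomorphImage _).trans
      (Homeomorph.setCongr ?_)
    exact Set.image_preimage_eq_of_subset hcube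

end ClosedDomain

/-! ### Maximal spectra of algebras of functions -/

namespace MVSubalgebra

open MVAlgebra

variable {X : Type*} {A : MVSubalgebra (X → I)}

theorem coe_neg_apply (f : A.carrier) (x : X) : ((neg f).1 x : ℝ) = 1 - f.1 x := rfl

theorem coe_oplus_apply (f g : A.carrier) (x : X) :
    ((oplus f g).1 x : ℝ) = min 1 ((f.1 x : ℝ) + g.1 x) := rfl

theorem coe_bot_apply (x : X) : (((bot : A.carrier)).1 x : ℝ) = 0 := rfl

theorem ext_of_coe {f g : A.carrier} (h : ∀ x, (f.1 x : ℝ) = g.1 x) : f = g :=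
  Subtype.ext (funext fun x => Subtype.ext (h x))

/-- Multiples with respect to the sum of the algebra. -/
noncomputable def multiple (f : A.carrier) : ℕ → A.carrier
  | 0 => bot
  | k + 1 => oplus (multiple f k) f

theorem coe_multiple_apply (f : A.carrier) (k : ℕ) (x : X) :
    ((multiple f k).1 x : ℝ) = min 1 ((k : ℝ) * (f.1 x : ℝ)) := by
  have hf := (f.1 x).2.1
  induction k with
  | zero => simp [multiple, coe_bot_apply]
  | succ k ih =>
    rw [multiple, coe_oplus_apply, ih]
    push_cast
    rcases min_cases 1 ((k : ℝ) * f.1 x) with h | h <;> rw [h.1, add_mul, one_mul]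
    rw [min_eq_left (by linarith), min_eq_left (by linarith)]

theorem exists_multiple_eq_one {f : A.carrier} {x : X} (h : (f.1 x : ℝ) ≠ 0) :
    ∃ k : ℕ, 1 < (k : ℝ) * f.1 x := by
  obtain ⟨k, hk⟩ := exists_nat_gt (1 / (f.1 x : ℝ))
  exact ⟨k, (div_lt_iff₀ (lt_of_le_of_ne (f.1 x).2.1 h.symm)).1 hk⟩

theorem multiple_mem {J : MVIdeal A.carrier} {f : A.carrier} (hf : f ∈ J.carrier) (k : ℕ) :
    multiple f k ∈ J.carrier := by
  induction k with
  | zero => exact J.bot_mem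
  | succ k ih => exact J.oplus_mem ih hf

theorem carrier_eq_univ {J : MVIdeal A.carrier} {f : A.carrier} (hf : f ∈ J.carrier)
    (h : ∀ x, (f.1 x : ℝ) = 1) : J.carrier = Set.univ := by
  have : f = neg bot := ext_of_coe fun x => by
    rw [h, coe_neg_apply, coe_bot_apply, sub_zero]
  subst this
  exact Set.eq_univ_of_forall fun g => J.mem_of_le (oplus_neg_bot _) hf

/-- The ideal of the functions that vanish at a point. -/
def idealAt (A : MVSubalgebra (X → I)) (p : X) : MVIdeal A.carrier where
  carrier := {f | (f.1 p : ℝ) = 0}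
  bot_mem := coe_bot_apply p
  mem_of_le := by
    intro f g hfg hg
    have h := congrArg (fun f : A.carrier => (f.1 p : ℝ)) hfg
    have hg' : (g.1 p : ℝ) = 0 := hg
    simp only [coe_oplus_apply, coe_neg_apply, coe_bot_apply, hg', add_zero, sub_zero] at h
    have h1 := min_le_right (1 : ℝ) (1 - f.1 p)
    rw [h] at h1
    exact le_antisymm (by linarith) (f.1 p).2.1
  oplus_mem := by
    intro f g hf hg
    have hf' : (f.1 p : ℝ) = 0 := hf
    have hg' : (g.1 p : ℝ) = 0 := hg
    change ((oplus f g).1 p : ℝ) = 0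
    rw [coe_oplus_apply, hf', hg', add_zero]
    exact min_eq_right zero_le_one

theorem mem_idealAt {p : X} {f : A.carrier} : f ∈ (A.idealAt p).carrier ↔ (f.1 p : ℝ) = 0 :=
  Iff.rfl

/-- If f(p) ≠ 0, some multiple g of f is 1 at p. Then ¬g vanishes at p, and a larger ideal
containing f contains ¬g ⊕ g = 1. -/
theorem isMaximal_idealAt (p : X) : (A.idealAt p).IsMaximal := by
  refine ⟨fun h => ?_, fun K hK hpK => MVIdeal.ext (Set.Subset.antisymm (fun f hf => ?_) hpK)⟩
  · have : (neg bot : A.carrier) ∈ (A.idealAt p).carrier := h ▸ Set.mem_univ _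
    rw [mem_idealAt, coe_neg_apply, coe_bot_apply] at this
    norm_num at this
  · by_contra hfp
    obtain ⟨k, hk⟩ := exists_multiple_eq_one (mt mem_idealAt.2 hfp)
    have h1 : neg (multiple f k) ∈ K.carrier := hpK (by
      rw [mem_idealAt, coe_neg_apply, coe_multiple_apply, min_eq_left hk.le, sub_self])
    refine hK (carrier_eq_univ (K.oplus_mem h1 (multiple_mem hf k)) fun x => ?_)
    rw [coe_oplus_apply, coe_neg_apply, sub_add_cancel, min_self]

variable [TopologicalSpace X]

/-- Otherwise each point of P has a neighbourhood on which a multiple of some member of J equals 1.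
Finitely many of these cover P, and their sum is 1 on P, hence everywhere. -/
theorem exists_eq_idealAt (hA : ∀ f ∈ A.carrier, Continuous f) {P : Set X} (hP : IsCompact P)
    (hPA : ∀ x, ∃ p ∈ P, ∀ f ∈ A.carrier, f x = f p) {J : MVIdeal A.carrier} (hJ : J.IsMaximal) :
    ∃ p ∈ P, A.idealAt p = J := by
  suffices h : ∃ p ∈ P, J.carrier ⊆ (A.idealAt p).carrier by
    obtain ⟨p, hp, h⟩ := h
    exact ⟨p, hp, hJ.2 _ (isMaximal_idealAt p).1 h⟩
  by_contra! h
  obtain ⟨f, hf, hfP⟩ : ∃ f ∈ J.carrier, ∀ x ∈ P, (f.1 x : ℝ) = 1 := by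
    refine hP.induction_on (p := fun S => ∃ f ∈ J.carrier, ∀ x ∈ S, (f.1 x : ℝ) = 1)
      ⟨bot, J.bot_mem, by simp⟩ ?_ ?_ ?_
    · rintro S T hST ⟨f, hf, hfT⟩
      exact ⟨f, hf, fun x hx => hfT x (hST hx)⟩
    · rintro S T ⟨f, hf, hfS⟩ ⟨g, hg, hgT⟩
      refine ⟨oplus f g, J.oplus_mem hf hg, fun x hx => ?_⟩
      have h1 := (f.1 x).2.1
      have h2 := (g.1 x).2.1
      rw [coe_oplus_apply]
      rcases hx with hx | hx
      · exact min_eq_left (by linarith [hfS x hx])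
      · exact min_eq_left (by linarith [hgT x hx])
    · intro p hp
      obtain ⟨f, hf, hfp⟩ := Set.not_subset.1 (h p hp)
      obtain ⟨k, hk⟩ := exists_multiple_eq_one (mt mem_idealAt.2 hfp)
      have hc : Continuous fun x => (k : ℝ) * (f.1 x : ℝ) :=
        continuous_const.mul (continuous_subtype_val.comp (hA _ f.2))
      refine ⟨{x | 1 < (k : ℝ) * f.1 x}, mem_nhdsWithin_of_mem_nhds
        ((isOpen_lt continuous_const hc).mem_nhds hk), multiple f k, multiple_mem hf k,
        fun x hx => ?_⟩
      rw [coe_multiple_apply]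
      exact min_eq_left (le_of_lt hx)
  refine hJ.1 (carrier_eq_univ hf fun x => ?_)
  obtain ⟨p, hp, hxp⟩ := hPA x
  rw [hxp _ f.2, hfP p hp]

/-- The maximal spectrum of a separating algebra of continuous functions. -/
theorem nonempty_homeomorph_maxSpec (hA : ∀ f ∈ A.carrier, Continuous f) {P : Set X}
    (hP : IsCompact P) (hPA : ∀ x, ∃ p ∈ P, ∀ f ∈ A.carrier, f x = f p)
    (hsep : ∀ p ∈ P, ∀ q ∈ P, p ≠ q → ∃ f ∈ A.carrier, (f p : ℝ) = 0 ∧ (f q : ℝ) ≠ 0) :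
    Nonempty (P ≃ₜ MVMaxSpec A.carrier) := by
  let φ : P → MVMaxSpec A.carrier := fun p => ⟨A.idealAt p, isMaximal_idealAt _⟩
  have hsurj : Function.Surjective φ := by
    rintro ⟨J, hJ⟩
    obtain ⟨p, hp, h⟩ := exists_eq_idealAt hA hP hPA hJ
    exact ⟨⟨p, hp⟩, Subtype.ext h⟩
  have hinj : Function.Injective φ := by
    intro p q hpq
    by_contra hne
    obtain ⟨f, hf, h1, h2⟩ := hsep p p.2 q q.2 fun h => hne (Subtype.ext h)
    have h3 : A.idealAt p = A.idealAt q := congrArg Subtype.val hpq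
    have h4 : (⟨f, hf⟩ : A.carrier) ∈ (A.idealAt p).carrier := h1
    rw [h3] at h4
    exact h2 h4
  have hcont : Continuous φ := by
    refine continuous_generateFrom_iff.2 ?_
    rintro _ ⟨a, rfl⟩
    exact (isOpen_ne_fun (continuous_subtype_val.comp ((hA _ a.2).comp continuous_subtype_val))
      continuous_const : IsOpen {p : P | (a.1 p : ℝ) ≠ 0})
  have hT2 : T2Space (MVMaxSpec A.carrier) := by
    refine ⟨fun J K hJK => ?_⟩
    obtain ⟨p, rfl⟩ := hsurj J
    obtain ⟨q, rfl⟩ := hsurj K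
    have hpq : (p : X) ≠ q := fun h => hJK (by rw [Subtype.ext h])
    obtain ⟨f, hf, h1, h2⟩ := hsep p p.2 q q.2 hpq
    obtain ⟨k, hk⟩ := exists_multiple_eq_one (f := (⟨f, hf⟩ : A.carrier)) h2
    set g := multiple (⟨f, hf⟩ : A.carrier) k with hg
    have hgp : (g.1 p : ℝ) = 0 := by
      rw [hg, coe_multiple_apply]
      simp [h1]
    have hgq : (g.1 q : ℝ) = 1 := by
      rw [hg, coe_multiple_apply, min_eq_left hk.le]
    -- `a` is nonzero exactly where g < 1/2 and `b` exactly where g > 1/2, so they define disjoint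
    -- open sets.
    let a : A.carrier := neg (oplus g g)
    let b : A.carrier := neg (oplus (neg g) (neg g))
    refine ⟨{J | a ∉ J.1.carrier}, {J | b ∉ J.1.carrier},
      TopologicalSpace.isOpen_generateFrom_of_mem ⟨a, rfl⟩,
      TopologicalSpace.isOpen_generateFrom_of_mem ⟨b, rfl⟩, ?_, ?_, ?_⟩
    · change ¬ (a.1 p : ℝ) = 0
      simp only [a, coe_neg_apply, coe_oplus_apply, hgp]
      norm_num
    · change ¬ (b.1 q : ℝ) = 0
      simp only [b, coe_neg_apply, coe_oplus_apply, hgq]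
      norm_num
    · rw [Set.disjoint_left]
      intro J hJ hJ'
      obtain ⟨x, rfl⟩ := hsurj J
      have h3 : ¬ (a.1 x : ℝ) = 0 := hJ
      have h4 : ¬ (b.1 x : ℝ) = 0 := hJ'
      simp only [a, b, coe_neg_apply, coe_oplus_apply] at h3 h4
      rcases le_total (1 / 2 : ℝ) (g.1 x) with h | h
      · rw [min_eq_left (by linarith), sub_self] at h3
        exact h3 rfl
      · rw [min_eq_left (by linarith), sub_self] at h4
        exact h4 rfl
  have : CompactSpace P := isCompact_iff_compactSpace.1 hP
  exact ⟨Continuous.homeoOfEquivCompactToT2 (f := Equiv.ofBijective φ ⟨hinj, hsurj⟩) hcont⟩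

-- While both values are on the same side of 1/2, one of x ⊕ x and ¬(¬x ⊕ ¬x) doubles their
-- difference. After at most k doublings they are 0 and 1, unless earlier f p ≤ 1/2 < f q, when ¬(¬x
-- ⊕ ¬x) separates at once.
omit [TopologicalSpace X] in
theorem exists_separating_of_lt (k : ℕ) {f : X → I} (hf : f ∈ A.carrier) {p q : X}
    (h : 1 ≤ 2 ^ k * ((f q : ℝ) - f p)) : ∃ g ∈ A.carrier, (g p : ℝ) = 0 ∧ (g q : ℝ) ≠ 0 := by
  induction k generalizing f with
  | zero =>
    have h1 := (f p).2.1
    have h2 := (f q).2.2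
    rw [pow_zero, one_mul] at h
    exact ⟨f, hf, by linarith, by linarith⟩
  | succ k ih =>
    rw [pow_succ, mul_assoc] at h
    rcases le_total (f q : ℝ) (1 / 2) with hq | hq
    · refine ih (A.oplus_mem hf hf) ?_
      have h1 : (f p : ℝ) ≤ 1 / 2 := by
        by_contra! h2
        have h3 : (0 : ℝ) < 2 ^ k := by positivity
        nlinarith
      change 1 ≤ 2 ^ k * (min 1 ((f q : ℝ) + f q) - min 1 ((f p : ℝ) + f p))
      rw [min_eq_right (by linarith), min_eq_right (by linarith)]
      linarith
    rcases le_total (1 / 2 : ℝ) (f p) with hp | hp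
    · refine ih (A.neg_mem (A.oplus_mem (A.neg_mem hf) (A.neg_mem hf))) ?_
      change 1 ≤ 2 ^ k * ((1 - min 1 ((1 - (f q : ℝ)) + (1 - f q))) -
        (1 - min 1 ((1 - (f p : ℝ)) + (1 - f p))))
      rw [min_eq_right (by linarith), min_eq_right (by linarith)]
      linarith
    rcases hq.eq_or_lt with hq | hq
    · refine ih (A.oplus_mem hf hf) ?_
      change 1 ≤ 2 ^ k * (min 1 ((f q : ℝ) + f q) - min 1 ((f p : ℝ) + f p))
      rw [min_eq_right (by linarith), min_eq_right (by linarith)]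
      linarith
    · refine ⟨_, A.neg_mem (A.oplus_mem (A.neg_mem hf) (A.neg_mem hf)), ?_, ?_⟩
      · change 1 - min 1 ((1 - (f p : ℝ)) + (1 - f p)) = 0
        rw [min_eq_left (by linarith), sub_self]
      · change 1 - min 1 ((1 - (f q : ℝ)) + (1 - f q)) ≠ 0
        rw [min_eq_right (by linarith [(f q).2.2])]
        intro h
        linarith

omit [TopologicalSpace X] in
theorem exists_separating {f : X → I} (hf : f ∈ A.carrier) {p q : X} (h : f p ≠ f q) :
    ∃ g ∈ A.carrier, (g p : ℝ) = 0 ∧ (g q : ℝ) ≠ 0 := by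
  have key : ∀ f ∈ A.carrier, (f p : ℝ) < f q →
      ∃ g ∈ A.carrier, (g p : ℝ) = 0 ∧ (g q : ℝ) ≠ 0 := by
    intro f hf hlt
    obtain ⟨k, hk⟩ := pow_unbounded_of_one_lt (1 / ((f q : ℝ) - f p)) one_lt_two
    exact exists_separating_of_lt k hf ((div_le_iff₀ (sub_pos.2 hlt)).1 hk.le)
  rcases lt_or_gt_of_ne (fun h' => h (Subtype.ext h') : (f p : ℝ) ≠ f q) with hlt | hlt
  · exact key f hf hlt
  · refine key _ (A.neg_mem hf) ?_
    change 1 - (f p : ℝ) < 1 - f q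
    linarith

/-- The subalgebra of the continuous functions that are invariant under a map. -/
def invariant (r : X → X) : MVSubalgebra (X → I) where
  carrier := {f | Continuous f ∧ ∀ x, f x = f (r x)}
  bot_mem := ⟨continuous_const, fun _ => rfl⟩
  neg_mem := fun hf => ⟨(continuous_const.sub (continuous_subtype_val.comp hf.1)).subtype_mk _,
    fun x => congrArg neg (hf.2 x)⟩
  oplus_mem := fun hf hg => ⟨(continuous_const.min
    ((continuous_subtype_val.comp hf.1).add (continuous_subtype_val.comp hg.1))).subtype_mk _,
    fun x => congrArg₂ oplus (hf.2 x) (hg.2 x)⟩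

end MVSubalgebra

/-! ### The maximal spectrum of the generated algebra -/

section MaxSpec

theorem continuous_hat (n : ℕ) (s : MVTerm) : Continuous (s.hat n) := by
  induction s with
  | zero => exact continuous_const
  | var i =>
    rw [MVTerm.hat, MVTerm.eval, MVTerm.proj]
    split_ifs
    · exact continuous_apply _
    · exact continuous_const
  | neg s ih => exact (continuous_const.sub (continuous_subtype_val.comp ih)).subtype_mk _
  | oplus s u ihs ihu =>
    exact (continuous_const.min
      ((continuous_subtype_val.comp ihs).add (continuous_subtype_val.comp ihu))).subtype_mk _

theorem continuous_hatMap (t : List MVTerm) : Continuous (hatMap t) :=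
  continuous_pi fun _ => continuous_hat _ _

variable {t : List MVTerm}

theorem hat_mem_genAlgebra (i : Fin t.length) :
    (t.get i).hat t.length ∈ (genAlgebra t).carrier := fun _ hB => hB ⟨i, rfl⟩

/-- Idempotence says that the generators are invariant under `hatMap t`, and invariance passes to
the generated subalgebra. -/
theorem genAlgebra_subset_invariant (ht : hatMap t ∘ hatMap t = hatMap t) :
    (genAlgebra t).carrier ⊆ (MVSubalgebra.invariant (hatMap t)).carrier := by
  intro f hf
  refine hf _ ?_
  rintro _ ⟨i, rfl⟩
  exact ⟨continuous_hat _ _, fun x => (congrFun (congrFun ht x) i).symm⟩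

/-- The maximal spectrum of the algebra generated by an idempotent tuple of McNaughton functions is
the set of its fixed points. -/
theorem nonempty_homeomorph_maxSpec_genAlgebra (ht : hatMap t ∘ hatMap t = hatMap t) :
    Nonempty (fixedSet t ≃ₜ MVMaxSpec (genAlgebra t).carrier) := by
  let P : Set (Fin t.length → I) := {x | hatMap t x = x}
  have hP : IsCompact P := (isClosed_eq (continuous_hatMap t) continuous_id).isCompact
  obtain ⟨e⟩ := MVSubalgebra.nonempty_homeomorph_maxSpec (A := genAlgebra t)
    (fun f hf => (genAlgebra_subset_invariant ht hf).1) hP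
    -- The retraction supplies a fixed point at which every function of the algebra takes the same
    -- value as at x.
    (fun x => ⟨hatMap t x, congrFun ht x, fun f hf => (genAlgebra_subset_invariant ht hf).2 x⟩)
    (fun p hp q hq hpq => by
      obtain ⟨i, hi⟩ := Function.ne_iff.1 hpq
      refine MVSubalgebra.exists_separating (hat_mem_genAlgebra i) (fun h => hi ?_)
      rw [← congrFun hp i, ← congrFun hq i]
      exact h)
  have hinj : Function.Injective fun (x : Fin t.length → I) i => (x i : ℝ) := fun x y hxy =>
    funext fun i => Subtype.ext (congrFun hxy i)
  have hfix : (fun (x : Fin t.length → I) i => (x i : ℝ)) '' P = fixedSet t := by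
    ext y
    exact ⟨fun ⟨x, hx, h⟩ => ⟨x, hx, h.symm⟩, fun ⟨x, hx, h⟩ => ⟨x, hx, h.symm⟩⟩
  exact ⟨((Homeomorph.setCongr hfix.symm).trans
    ((Topology.IsEmbedding.mk isInducing_coe_cube hinj).homeomorphImage P).symm).trans e⟩

theorem maxSpecIsClosedDomain_iff (ht : IsInstance t) :
    MaxSpecIsClosedDomain t ↔
      ∀ s ∈ (ConeComplex.complex (ConeComplex.fixedCode_spec ht.2.1).1).facets,
        s.card = t.length + 1 := by
  have hspace := ConeComplex.space_complex_fixedCode ht.2.1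
  rw [← exists_closedDomain_homeomorph_iff (ConeComplex.finite_faces_complex _)]
  · obtain ⟨e⟩ := nonempty_homeomorph_maxSpec_genAlgebra ht.2.2
    have e' := (Homeomorph.setCongr hspace).trans e
    exact exists_congr fun D => and_congr_right fun _ =>
      ⟨fun ⟨f⟩ => ⟨e'.trans f⟩, fun ⟨f⟩ => ⟨e'.symm.trans f⟩⟩
  · rw [hspace]
    rintro y ⟨x, -, rfl⟩
    exact ⟨x, rfl⟩

end MaxSpec

/-! ### The decision procedures -/

theorem mainTheorem9 :
    -- the hypothesis on the instances is decidable
    ComputablePred IsInstance ∧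
    -- for such instances, it is decidable whether the answer to the question is positive
    (∃ decision : List MVTerm → Bool, Computable decision ∧
      ∀ t : List MVTerm, IsInstance t → (decision t = true ↔ MaxSpecIsClosedDomain t)) ∧
    -- a triangulation of the fixed-point set is computable, and the answer is positive
    -- iff all its maximal simplexes are `n`-dimensional
    (∃ triangulation : List MVTerm → List (List RatPointCode), Computable triangulation ∧
      ∀ t : List MVTerm, IsInstance t →
        ∃ K : Geometry.SimplicialComplex ℝ (Fin t.length → ℝ),
          K.faces = vertexSets t.length (triangulation t) ∧
          K.space = fixedSet t ∧
          (MaxSpecIsClosedDomain t ↔ ∀ s ∈ K.facets, s.card = t.length + 1)) := by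
  have hfaces : Primrec fun t => ConeComplex.facesCode (ConeComplex.fixedCode t) :=
    ConeComplex.primrec_facesCode.comp ConeComplex.primrec_fixedCode
  refine ⟨ConeComplex.computablePred_isInstance, ?_, _, hfaces.to_comp, fun t ht =>
    ⟨ConeComplex.complex (ConeComplex.fixedCode_spec ht.2.1).1, rfl,
      ConeComplex.space_complex_fixedCode ht.2.1, maxSpecIsClosedDomain_iff ht⟩⟩
  -- The decision is the purity test on the computed list of faces.
  obtain ⟨_, h⟩ := ConeComplex.primrecRel_isPure.comp Primrec.list_length hfaces
  refine ⟨_, h.to_comp, fun t ht => ?_⟩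
  rw [decide_eq_true_iff, maxSpecIsClosedDomain_iff ht]
  exact ConeComplex.isPure_iff _ (ConeComplex.fixedCode_spec ht.2.1).2.1
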